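/- Let $M$ be a smooth ($C^\infty$, Hausdorff, second countable) manifold of dimension $n\ge 3$ with a Finsler structure $L:TM\to[0,\infty)$: $L$ is continuous on $TM$, smooth and positive on the slit tangent bundle $\mathcal TM$ of nonzero tangent vectors, positively homogeneous of degree one, and its vertical Hessian $g=\tfrac12\,\mathrm{Hess}_y(L^2)$ is positive definite on $\mathcal TM$. Let $\pi^{-1}(TM)$ be the pullback of $TM$ to $\mathcal TM$ (its sections are called $\pi$-vector fields), $\rho=d\pi:T(\mathcal TM)\to\pi^{-1}(TM)$, $\gamma:\pi^{-1}(TM)\to T(\mathcal TM)$ the vertical lift, and $\eta(u)=(u,u)$. Let $\nabla$ be the Cartan connection, i.e. the linear connection on $\pi^{-1}(TM)$ such that, with $K(\xi)=\nabla_\xi\eta$ and $H_u=\ker K_u$: $T_u(\mathcal TM)=\ker\rho_u\oplus H_u$ for all $u$ (regularity; put $\beta=(\rho|_H)^{-1}$); $\nabla g=0$; the torsion $\mathbf T(\xi,\zeta)=\nabla_\xi\rho\zeta-\nabla_\zeta\rho\xi-\rho[\xi,\zeta]$ satisfies $\mathbf T(\beta X,\beta Y)=0$; and $g(\mathbf T(\gamma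 X,\beta Y),Z)=g(\mathbf T(\gamma X,\beta Z),Y)$. Put $$R(X,Y)Z=-\nabla_{\beta X}\nabla_{\beta Y}Z+\nabla_{\beta Y}\nabla_{\beta X}Z+\nabla_{[\beta X,\beta Y]}Z,\qquad G(X,Y)Z=g(X,Z)Y-g(Y,Z)X,$$ $\mathbf R(X,Y,Z,W)=g(R(X,Y)Z,W)$. Let $\overset{h}{\nabla}$ be the covariant derivative along $\beta$-lifts, with the differentiating argument written first, so that $(\overset{h}{\nabla}A)(X,Y)=(\beta X)(A(Y))-A(\nabla_{\beta X}Y)$ for a scalar $\pi$-1-form $A$, and put $\overline dA(X,Y)=(\overset{h}{\nabla}A)(X,Y)-(\overset{h}{\nabla}A)(Y,X)$, $(A\wedge B)(X,Y)=A(X)B(Y)-A(Y)B(X)$. Assume that the horizontal distribution $H$ is completely integrable (closed under brackets of its sections), and that $$\overset{h}{\nabla}R=A\otimes R+B\otimes G$$ for smooth scalar $\pi$-1-forms $A,B$ on $\mathcal TM$, positively homogeneous of degree zero in $y$. Then, for all $\pi$-vector fields $X,Y,Z,W$: (a) the cyclic sum over $X,Y,Z$ of $A(X)R(Y,Z)W+B(X)G(Y,Z)W$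 vanishes; (b) $\overline dB+A\wedge B$ vanishes identically; $\overline dA$ vanishes at every point of $\mathcal TM$ at which $R\ne0$; and $\overline dA$ vanishes identically if $(M,L)$ is generalized recurrent with recurrence forms $A,B$, that is, if moreover none of the tensor fields $R$, $A$, $B$ is identically zero; (c) $R(X,Y)\mathbf R=0$, where $R(X,Y)$ acts on $\mathbf R$ as a derivation: $(R(X,Y)\mathbf R)(U,V,W,Z)=-\mathbf R(R(X,Y)U,V,W,Z)-\mathbf R(U,R(X,Y)V,W,Z)-\mathbf R(U,V,R(X,Y)W,Z)-\mathbf R(U,V,W,R(X,Y)Z)$. -/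

import Mathlib

open Bundle Set
open scoped Manifold ContDiff

noncomputable section

namespace Finsler

section Geometry

variable {E : Type*} [NormedAddCommGroup E] [NormedSpace ℝ E]
  {M : Type*} [TopologicalSpace M] [ChartedSpace E M] [IsManifold 𝓘(ℝ, E) ∞ M]

/-! ### The slit tangent bundle and the pullback bundle -/

/-- The slit tangent bundle `𝒯M`: the open set of nonzero tangent vectors in `TM`. -/
def slit (E : Type*) [NormedAddCommGroup E] [NormedSpace ℝ E]
    (M : Type*) [TopologicalSpace M] [ChartedSpace E M] [IsManifold 𝓘(ℝ, E) ∞ M] :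
    Set (TangentBundle 𝓘(ℝ, E) M) :=
  {u | u.snd ≠ 0}

/-- The projection `π : TM → M` as a smooth map. -/
def tangentProj (E : Type*) [NormedAddCommGroup E] [NormedSpace ℝ E]
    (M : Type*) [TopologicalSpace M] [ChartedSpace E M] [IsManifold 𝓘(ℝ, E) ∞ M] :
    ContMDiffMap 𝓘(ℝ, E).tangent 𝓘(ℝ, E) (TangentBundle 𝓘(ℝ, E) M) M ∞ :=
  ⟨TotalSpace.proj, contMDiff_proj (TangentSpace 𝓘(ℝ, E))⟩

/-- The pullback bundle `π⁻¹(TM)`, whose fibre over `u ∈ TM` is the tangent space of `M` at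
`π(u)`. -/
abbrev PB (E : Type*) [NormedAddCommGroup E] [NormedSpace ℝ E]
    (M : Type*) [TopologicalSpace M] [ChartedSpace E M] [IsManifold 𝓘(ℝ, E) ∞ M] :
    TangentBundle 𝓘(ℝ, E) M → Type _ :=
  (tangentProj E M) *ᵖ (TangentSpace 𝓘(ℝ, E) : M → Type _)

instance (u : TangentBundle 𝓘(ℝ, E) M) : AddCommGroup (PB E M u) :=
  inferInstanceAs (AddCommGroup (TangentSpace 𝓘(ℝ, E) u.proj))

instance (u : TangentBundle 𝓘(ℝ, E) M) : IsTopologicalAddGroup (PB E M u) :=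
  inferInstanceAs (IsTopologicalAddGroup (TangentSpace 𝓘(ℝ, E) u.proj))

instance (u : TangentBundle 𝓘(ℝ, E) M) : ContinuousSMul ℝ (PB E M u) :=
  inferInstanceAs (ContinuousSMul ℝ (TangentSpace 𝓘(ℝ, E) u.proj))

/-- A section of the pullback bundle is a `π`-vector field if it is smooth on `𝒯M`. (Its values
on the zero section never matter.) -/
def IsPiVectorField (X : Π u : TangentBundle 𝓘(ℝ, E) M, PB E M u) : Prop :=
  ContMDiffOn 𝓘(ℝ, E).tangent (𝓘(ℝ, E).tangent.prod 𝓘(ℝ, E)) ∞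
    (fun u ↦ TotalSpace.mk' E u (X u)) (slit E M)

/-- Smooth vector fields on `𝒯M`. -/
def IsVectorField (X : Π u : TangentBundle 𝓘(ℝ, E) M, TangentSpace 𝓘(ℝ, E).tangent u) : Prop :=
  ContMDiffOn 𝓘(ℝ, E).tangent 𝓘(ℝ, E).tangent.tangent ∞
    (fun u ↦ (⟨u, X u⟩ : TangentBundle 𝓘(ℝ, E).tangent (TangentBundle 𝓘(ℝ, E) M))) (slit E M)

/-- The fundamental `π`-vector field `η(u) = (u, u)`. -/
def eta (u : TangentBundle 𝓘(ℝ, E) M) : PB E M u := u.snd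

/-- The bundle morphism `ρ : T(𝒯M) → π⁻¹(TM)`, that is, `dπ`. -/
def rho (u : TangentBundle 𝓘(ℝ, E) M) : TangentSpace 𝓘(ℝ, E).tangent u →L[ℝ] PB E M u :=
  mfderiv 𝓘(ℝ, E).tangent 𝓘(ℝ, E) (tangentProj E M) u

/-- The bundle morphism `γ : π⁻¹(TM) → T(𝒯M)`: `γ(u, v)` is the velocity at `t = 0` of the curve
`t ↦ u + t v` in the fibre of `u`. -/
def gamma (u : TangentBundle 𝓘(ℝ, E) M) (v : TangentSpace 𝓘(ℝ, E) u.proj) : TangentSpace 𝓘(ℝ, E).tangent u :=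
  mfderiv 𝓘(ℝ, ℝ) 𝓘(ℝ, E).tangent
    (fun t : ℝ ↦ (⟨u.proj, u.snd + t • v⟩ :
      TangentBundle 𝓘(ℝ, E) M)) 0 (1 : ℝ)

/-! ### Finsler structures -/

/-- The Finsler metric of `L`: the vertical Hessian of `L² / 2`, a bilinear form on each fibre of
the pullback bundle. -/
def metric (L : TangentBundle 𝓘(ℝ, E) M → ℝ) (u : TangentBundle 𝓘(ℝ, E) M)
    (v w : TangentSpace 𝓘(ℝ, E) u.proj) : ℝ :=
  deriv (fun s : ℝ ↦ deriv (fun t : ℝ ↦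
    (1 / 2 : ℝ) * L ⟨u.proj, u.snd + s • v
      + t • w⟩ ^ 2) 0) 0

/-- `L` is a Finsler structure on `M`. -/
structure IsFinslerStructure (L : TangentBundle 𝓘(ℝ, E) M → ℝ) : Prop where
  continuous : Continuous L
  smooth : ContMDiffOn 𝓘(ℝ, E).tangent 𝓘(ℝ, ℝ) ∞ L (slit E M)
  pos : ∀ u ∈ slit E M, 0 < L u
  homogeneous : ∀ (x : M) (y : TangentSpace 𝓘(ℝ, E) x) (c : ℝ), 0 < c →
    L ⟨x, c • y⟩ = c * L ⟨x, y⟩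
  posDef : ∀ u ∈ slit E M, ∀ v : PB E M u, v ≠ 0 → 0 < metric L u v v

/-! ### Linear connections on the pullback bundle

`D σ u ξ` stands for `(D_ξ σ)(u)`, where `σ` is a section of `π⁻¹(TM)` and `ξ` a tangent vector of
`TM` at `u`. -/

/-- The type of the operators `D` underlying a linear connection on `π⁻¹(TM)`. -/
abbrev Conn (E : Type*) [NormedAddCommGroup E] [NormedSpace ℝ E]
    (M : Type*) [TopologicalSpace M] [ChartedSpace E M] [IsManifold 𝓘(ℝ, E) ∞ M] :=
  (Π u : TangentBundle 𝓘(ℝ, E) M, PB E M u) →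
    (Π u : TangentBundle 𝓘(ℝ, E) M, TangentSpace 𝓘(ℝ, E).tangent u →L[ℝ] PB E M u)

/-- `D` is a (smooth) linear connection on `π⁻¹(TM)` over `𝒯M`. -/
structure IsLinearConnection (D : Conn E M) : Prop where
  isCovariantDerivativeOn : IsCovariantDerivativeOn E D (slit E M)
  smooth : ContMDiffCovariantDerivativeOn E ∞ D (slit E M)

/-- The connection map `K(X) = D_X η`. -/
def connMap (D : Conn E M) (u : TangentBundle 𝓘(ℝ, E) M) :
    TangentSpace 𝓘(ℝ, E).tangent u →L[ℝ] PB E M u :=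
  D eta u

/-- The vertical space at `u`. -/
def vertical (u : TangentBundle 𝓘(ℝ, E) M) : Submodule ℝ (TangentSpace 𝓘(ℝ, E).tangent u) :=
  LinearMap.ker (rho u).toLinearMap

/-- The horizontal space of `D` at `u`. -/
def horizontal (D : Conn E M) (u : TangentBundle 𝓘(ℝ, E) M) :
    Submodule ℝ (TangentSpace 𝓘(ℝ, E).tangent u) :=
  LinearMap.ker (connMap D u).toLinearMap

/-- `D` is regular: `T_u(𝒯M) = V_u(𝒯M) ⊕ H_u(𝒯M)` at every `u ∈ 𝒯M`. -/
def IsRegular (D : Conn E M) : Prop :=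
  ∀ u ∈ slit E M, IsCompl (vertical u) (horizontal D u)

/-- The horizontal map `β = (ρ|_H)⁻¹` of a regular connection: `β_u(v)` is the tangent vector `ξ`
with `(ρ(ξ), K(ξ)) = (v, 0)`; see `rho_beta`, `beta_mem_horizontal` and
`beta_rho` below. -/
def beta (D : Conn E M) (u : TangentBundle 𝓘(ℝ, E) M) (v : PB E M u) :
    TangentSpace 𝓘(ℝ, E).tangent u :=
  ((rho u).prod (connMap D u)).inverse (v, 0)

/-- The horizontal lift `βX` of a section `X` of the pullback bundle. -/
def hLift (D : Conn E M) (X : Π u : TangentBundle 𝓘(ℝ, E) M, PB E M u) :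
    Π u : TangentBundle 𝓘(ℝ, E) M, TangentSpace 𝓘(ℝ, E).tangent u :=
  fun u ↦ beta D u (X u)

/-- The vertical lift `γX` of a section `X` of the pullback bundle. -/
def vLift (X : Π u : TangentBundle 𝓘(ℝ, E) M, PB E M u) :
    Π u : TangentBundle 𝓘(ℝ, E) M, TangentSpace 𝓘(ℝ, E).tangent u :=
  fun u ↦ gamma u (X u)

/-- The classical torsion `𝐓(X, Y) = D_X ρY - D_Y ρX - ρ[X, Y]` of `D`. -/
def torsion (D : Conn E M) (X Y : Π u : TangentBundle 𝓘(ℝ, E) M, TangentSpace 𝓘(ℝ, E).tangent u)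
    (u : TangentBundle 𝓘(ℝ, E) M) : PB E M u :=
  D (fun w ↦ rho w (Y w)) u (X u) - D (fun w ↦ rho w (X w)) u (Y u)
    - rho u (VectorField.mlieBracket 𝓘(ℝ, E).tangent X Y u)

/-- The classical curvature of `D`, with the sign convention
`𝐊(X, Y)Z = -D_X D_Y Z + D_Y D_X Z + D_{[X, Y]} Z`. -/
def curvature (D : Conn E M)
    (X Y : Π u : TangentBundle 𝓘(ℝ, E) M, TangentSpace 𝓘(ℝ, E).tangent u)
    (Z : Π u : TangentBundle 𝓘(ℝ, E) M, PB E M u) (u : TangentBundle 𝓘(ℝ, E) M) : PB E M u :=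
  -(D (fun w ↦ D Z w (Y w)) u (X u)) + D (fun w ↦ D Z w (X w)) u (Y u)
    + D Z u (VectorField.mlieBracket 𝓘(ℝ, E).tangent X Y u)

/-- `D` is the Cartan connection of `(M, L)`: the (unique) regular linear connection on `π⁻¹(TM)`
that is metric, has vanishing (h)h-torsion `Q(X, Y) = 𝐓(βX, βY)`, and whose (h)hv-torsion
`T(X, Y) = 𝐓(γX, βY)` satisfies `g(T(X, Y), Z) = g(T(X, Z), Y)`. -/
structure IsCartanConnection (L : TangentBundle 𝓘(ℝ, E) M → ℝ) (D : Conn E M) : Prop where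
  linear : IsLinearConnection D
  regular : IsRegular D
  isMetric : ∀ Y Z : Π u : TangentBundle 𝓘(ℝ, E) M, PB E M u,
    IsPiVectorField Y → IsPiVectorField Z →
    ∀ u ∈ slit E M, ∀ ξ : TangentSpace 𝓘(ℝ, E).tangent u,
      mvfderiv 𝓘(ℝ, E).tangent (fun w ↦ metric L w (Y w) (Z w)) u ξ =
        metric L u (D Y u ξ) (Z u) + metric L u (Y u) (D Z u ξ)
  torsion_hh : ∀ X Y : Π u : TangentBundle 𝓘(ℝ, E) M, PB E M u,
    IsPiVectorField X → IsPiVectorField Y →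
    ∀ u ∈ slit E M, torsion D (hLift D X) (hLift D Y) u = 0
  torsion_hv : ∀ X Y Z : Π u : TangentBundle 𝓘(ℝ, E) M, PB E M u,
    IsPiVectorField X → IsPiVectorField Y → IsPiVectorField Z →
    ∀ u ∈ slit E M,
      metric L u (torsion D (vLift X) (hLift D Y) u) (Z u) =
        metric L u (torsion D (vLift X) (hLift D Z) u) (Y u)

/-- The horizontal distribution of `D` on `𝒯M` is completely integrable, that is, involutive: the
bracket of two horizontal vector fields is horizontal. -/
def IsHorizontallyIntegrable (D : Conn E M) : Prop :=
  ∀ X Y : Π u : TangentBundle 𝓘(ℝ, E) M, TangentSpace 𝓘(ℝ, E).tangent u,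
    IsVectorField X → IsVectorField Y →
    (∀ u ∈ slit E M, X u ∈ horizontal D u) → (∀ u ∈ slit E M, Y u ∈ horizontal D u) →
    ∀ u ∈ slit E M, VectorField.mlieBracket 𝓘(ℝ, E).tangent X Y u ∈ horizontal D u

/-! ### The tensors of the theory -/

/-- The h-curvature tensor `R(X, Y)Z = 𝐊(βX, βY)Z`. -/
def hCurv (D : Conn E M) (X Y Z : Π u : TangentBundle 𝓘(ℝ, E) M, PB E M u) :
    Π u : TangentBundle 𝓘(ℝ, E) M, PB E M u :=
  curvature D (hLift D X) (hLift D Y) Z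

/-- `G(X, Y)Z = g(X, Z)Y - g(Y, Z)X`. -/
def tensorG (L : TangentBundle 𝓘(ℝ, E) M → ℝ)
    (X Y Z : Π u : TangentBundle 𝓘(ℝ, E) M, PB E M u) :
    Π u : TangentBundle 𝓘(ℝ, E) M, PB E M u :=
  fun u ↦ metric L u (X u) (Z u) • Y u - metric L u (Y u) (Z u) • X u

/-- `𝐑(X, Y, Z, W) = g(R(X, Y)Z, W)`. -/
def curvForm (L : TangentBundle 𝓘(ℝ, E) M → ℝ) (D : Conn E M)
    (X Y Z W : Π u : TangentBundle 𝓘(ℝ, E) M, PB E M u) (u : TangentBundle 𝓘(ℝ, E) M) : ℝ :=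
  metric L u (hCurv D X Y Z u) (W u)

/-- `R(X, Y)𝐑`, where the endomorphism `R(X, Y)` acts on tensors as a derivation that commutes with
contractions and kills functions. -/
def curvActCurv (L : TangentBundle 𝓘(ℝ, E) M → ℝ) (D : Conn E M)
    (X Y U V W Z : Π u : TangentBundle 𝓘(ℝ, E) M, PB E M u)
    (u : TangentBundle 𝓘(ℝ, E) M) : ℝ :=
  -(curvForm L D (hCurv D X Y U) V W Z u) - curvForm L D U (hCurv D X Y V) W Z u
    - curvForm L D U V (hCurv D X Y W) Z u - curvForm L D U V W (hCurv D X Y Z) u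

/-- The h-covariant derivative `D_{βX} Y` of a `π`-vector field. -/
def hCov (D : Conn E M) (X Y : Π u : TangentBundle 𝓘(ℝ, E) M, PB E M u) :
    Π u : TangentBundle 𝓘(ℝ, E) M, PB E M u :=
  fun u ↦ D Y u (beta D u (X u))

/-- The h-covariant derivative of a `π`-1-form:
`(∇ʰA)(X, Y) = (βX)(A(Y)) - A(D_{βX} Y)`. -/
def hCovForm (D : Conn E M) (A : Π u : TangentBundle 𝓘(ℝ, E) M, PB E M u →L[ℝ] ℝ)
    (X Y : Π u : TangentBundle 𝓘(ℝ, E) M, PB E M u) (u : TangentBundle 𝓘(ℝ, E) M) : ℝ :=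
  mvfderiv 𝓘(ℝ, E).tangent (fun w ↦ A w (Y w)) u (beta D u (X u)) - A u (hCov D X Y u)

/-- The h-covariant derivative of the h-curvature: `(∇ʰR)(X, Y, Z, W) = (∇ʰ_X R)(Y, Z)W`. -/
def hCovCurv (D : Conn E M) (X Y Z W : Π u : TangentBundle 𝓘(ℝ, E) M, PB E M u) :
    Π u : TangentBundle 𝓘(ℝ, E) M, PB E M u :=
  fun u ↦ hCov D X (hCurv D Y Z W) u - hCurv D (hCov D X Y) Z W u
    - hCurv D Y (hCov D X Z) W u - hCurv D Y Z (hCov D X W) u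

/-- `d̄A(X, Y) = (∇ʰA)(X, Y) - (∇ʰA)(Y, X)`. -/
def dBar (D : Conn E M) (A : Π u : TangentBundle 𝓘(ℝ, E) M, PB E M u →L[ℝ] ℝ)
    (X Y : Π u : TangentBundle 𝓘(ℝ, E) M, PB E M u) (u : TangentBundle 𝓘(ℝ, E) M) : ℝ :=
  hCovForm D A X Y u - hCovForm D A Y X u

/-- `(A ∧ B)(X, Y) = A(X)B(Y) - A(Y)B(X)`. -/
def wedge (A B : Π u : TangentBundle 𝓘(ℝ, E) M, PB E M u →L[ℝ] ℝ)
    (X Y : Π u : TangentBundle 𝓘(ℝ, E) M, PB E M u) (u : TangentBundle 𝓘(ℝ, E) M) : ℝ :=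
  A u (X u) * B u (Y u) - A u (Y u) * B u (X u)

/-- `(A ⊗ R + B ⊗ G)(X, Y, Z, W) = A(X) R(Y, Z)W + B(X) G(Y, Z)W`. -/
def recTensor (L : TangentBundle 𝓘(ℝ, E) M → ℝ) (D : Conn E M)
    (A B : Π u : TangentBundle 𝓘(ℝ, E) M, PB E M u →L[ℝ] ℝ)
    (X Y Z W : Π u : TangentBundle 𝓘(ℝ, E) M, PB E M u) :
    Π u : TangentBundle 𝓘(ℝ, E) M, PB E M u :=
  fun u ↦ A u (X u) • hCurv D Y Z W u + B u (X u) • tensorG L Y Z W u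

/-! ### Generalized recurrence -/

/-- A scalar `π`-1-form on `𝒯M`: smooth, and positively homogeneous of degree zero in `y`. -/
structure IsScalarForm (A : Π u : TangentBundle 𝓘(ℝ, E) M, PB E M u →L[ℝ] ℝ) : Prop where
  smooth : ∀ X : Π u : TangentBundle 𝓘(ℝ, E) M, PB E M u, IsPiVectorField X →
    ContMDiffOn 𝓘(ℝ, E).tangent 𝓘(ℝ, ℝ) ∞ (fun u ↦ A u (X u)) (slit E M)
  homogeneous : ∀ (x : M) (y v : TangentSpace 𝓘(ℝ, E) x), y ≠ 0 → ∀ c : ℝ, 0 < c →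
    A ⟨x, c • y⟩ v = A ⟨x, y⟩ v

/-- The recurrence equation `∇ʰR = A ⊗ R + B ⊗ G` on `𝒯M`. -/
def RecurrenceEquation (L : TangentBundle 𝓘(ℝ, E) M → ℝ) (D : Conn E M)
    (A B : Π u : TangentBundle 𝓘(ℝ, E) M, PB E M u →L[ℝ] ℝ) : Prop :=
  ∀ X Y Z W : Π u : TangentBundle 𝓘(ℝ, E) M, PB E M u,
    IsPiVectorField X → IsPiVectorField Y → IsPiVectorField Z → IsPiVectorField W →
    ∀ u ∈ slit E M, hCovCurv D X Y Z W u = recTensor L D A B X Y Z W u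

/-- The h-curvature tensor is nonzero at the point `u`. -/
def HCurvNeZeroAt (D : Conn E M) (u : TangentBundle 𝓘(ℝ, E) M) : Prop :=
  ∃ X Y Z : Π u : TangentBundle 𝓘(ℝ, E) M, PB E M u,
    IsPiVectorField X ∧ IsPiVectorField Y ∧ IsPiVectorField Z ∧ hCurv D X Y Z u ≠ 0

/-- `(M, L)`, with Cartan connection `D`, is generalized recurrent with recurrence forms `A`, `B`:
`R`, `A` and `B` are nonzero as tensor fields on `𝒯M`, and `∇ʰR = A ⊗ R + B ⊗ G`. -/
structure IsGeneralizedRecurrent (L : TangentBundle 𝓘(ℝ, E) M → ℝ) (D : Conn E M)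
    (A B : Π u : TangentBundle 𝓘(ℝ, E) M, PB E M u →L[ℝ] ℝ) : Prop where
  curv_ne_zero : ∃ u ∈ slit E M, HCurvNeZeroAt D u
  formA : IsScalarForm A
  formB : IsScalarForm B
  formA_ne_zero : ∃ u ∈ slit E M, A u ≠ 0
  formB_ne_zero : ∃ u ∈ slit E M, B u ≠ 0
  equation : RecurrenceEquation L D A B

end Geometry

/-! ### The horizontal map is the inverse of `ρ` on the horizontal spaces -/

section Beta

variable {E : Type*} [NormedAddCommGroup E] [NormedSpace ℝ E] [FiniteDimensional ℝ E]
  {M : Type*} [TopologicalSpace M] [ChartedSpace E M] [IsManifold 𝓘(ℝ, E) ∞ M]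

theorem isInvertible_rho_prod_connMap {D : Conn E M} (hD : IsRegular D)
    {u : TangentBundle 𝓘(ℝ, E) M} (hu : u ∈ slit E M) :
    ((rho u).prod (connMap D u)).IsInvertible := by
  have : FiniteDimensional ℝ (TangentSpace 𝓘(ℝ, E).tangent u) :=
    inferInstanceAs (FiniteDimensional ℝ (E × E))
  have : FiniteDimensional ℝ (PB E M u) := inferInstanceAs (FiniteDimensional ℝ E)
  have hinj : Function.Injective ((rho u).prod (connMap D u)).toLinearMap := by
    rw [injective_iff_map_eq_zero]
    intro ξ hξ
    have h1 : rho u ξ = 0 := congrArg Prod.fst hξ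
    have h2 : connMap D u ξ = 0 := congrArg Prod.snd hξ
    have h3 : ξ ∈ vertical u ⊓ horizontal D u := ⟨h1, h2⟩
    rwa [(hD u hu).inf_eq_bot, Submodule.mem_bot] at h3
  have : T2Space (TangentSpace 𝓘(ℝ, E).tangent u) := inferInstanceAs (T2Space (E × E))
  have : T2Space (PB E M u) := inferInstanceAs (T2Space E)
  have hdim : Module.finrank ℝ (TangentSpace 𝓘(ℝ, E).tangent u) =
      Module.finrank ℝ (PB E M u × PB E M u) := rfl
  refine ⟨(LinearEquiv.ofInjectiveOfFinrankEq _ hinj hdim).toContinuousLinearEquiv, ?_⟩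
  ext1 ξ
  rfl

/-- `ρ(βv) = v`. -/
theorem rho_beta {D : Conn E M} (hD : IsRegular D) {u : TangentBundle 𝓘(ℝ, E) M}
    (hu : u ∈ slit E M) (v : PB E M u) : rho u (beta D u v) = v := by
  have h := (isInvertible_rho_prod_connMap hD hu).self_apply_inverse (v, 0)
  exact congrArg Prod.fst h

/-- `βv` is horizontal. -/
theorem beta_mem_horizontal {D : Conn E M} (hD : IsRegular D) {u : TangentBundle 𝓘(ℝ, E) M}
    (hu : u ∈ slit E M) (v : PB E M u) : beta D u v ∈ horizontal D u := by
  have h := (isInvertible_rho_prod_connMap hD hu).self_apply_inverse (v, 0)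
  exact congrArg Prod.snd h

/-- `β(ρξ) = ξ` for horizontal `ξ`. -/
theorem beta_rho {D : Conn E M} (hD : IsRegular D) {u : TangentBundle 𝓘(ℝ, E) M}
    (hu : u ∈ slit E M) (ξ : TangentSpace 𝓘(ℝ, E).tangent u) (hξ : ξ ∈ horizontal D u) :
    beta D u (rho u ξ) = ξ := by
  have h := (isInvertible_rho_prod_connMap hD hu).inverse_apply_self ξ
  have h2 : ((rho u).prod (connMap D u)) ξ = (rho u ξ, 0) := Prod.ext rfl hξ
  rw [h2] at h
  exact h

end Beta

end Finsler

end

/-! Integrability of `H` together with the vanishing of the (h)h-torsion gives `[βX, βY] = β(∇_{βX}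
Y - ∇_{βY} X)`. Hence the h-covariant derivative behaves like a torsion-free connection on the
module of `π`-vector fields over the ring of smooth functions on `𝒯M`, and the Jacobi identity for
horizontal lifts yields both Bianchi identities for `R` (`first_bianchi`, `second_bianchi`). Part
(a) is the second Bianchi identity with the recurrence equation substituted.

The decisive fact is that `η` is horizontally parallel, since `K(βX) = 0`. So `R(X, Y)η = 0`, and
the covariant derivative of `R` also vanishes when its last argument is `η`. Evaluating the
recurrence equation at `(X, η, Z, η)` leaves `B(X) (g(η, η) Z - g(Z, η) η) = 0`; a `Z` independent
of `η` forces `B = 0` (`formB_eq_zero`). Thus `d̄B + A ∧ B = 0` is trivial, no generalized recurrent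
structure exists under these hypotheses, and the equation reduces to `∇ʰR = A ⊗ R`.

Differentiating once more gives the Ricci identity `R(X, Y) · R = -d̄A(X, Y) R`
(`curv_act_of_recurrent`). As `∇` is metric, `R(X, Y)` is skew-symmetric, so it acts as a skew
endomorphism on the Euclidean space of tensors and has no nonzero real eigenvalue there
(`eigenvalue_eq_zero_of_skew`). Hence at each point `d̄A = 0` or `R = 0`. This is the second claim
of (b), and in either case the Ricci identity gives (c). -/

namespace Finsler

/-! ### Algebra of a torsion-free covariant derivative: Bianchi and Ricci identities -/

section Calculus

/-- An algebraic model of a covariant derivative whose bracket `∇_x y - ∇_y x` satisfies the Jacobi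
identity: `X` plays the role of the vector fields, `R` of the functions. -/
structure CovCalculus (R X : Type*) [CommRing R] [AddCommGroup X] [Module R X] where
  nabla : X →+ X →+ X
  der : X → R →+ R
  nabla_smul_left : ∀ (f : R) (x y : X), nabla (f • x) y = f • nabla x y
  nabla_smul : ∀ (f : R) (x y : X), nabla x (f • y) = der x f • y + f • nabla x y
  jacobi : ∀ x y z : X,
    nabla x (nabla y z - nabla z y) - nabla (nabla y z - nabla z y) x =
      nabla (nabla x y - nabla y x) z - nabla z (nabla x y - nabla y x) +
        (nabla y (nabla x z - nabla z x) - nabla (nabla x z - nabla z x) y)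

namespace CovCalculus

variable {R X : Type*} [CommRing R] [AddCommGroup X] [Module R X] (N : CovCalculus R X)

/-- The curvature `-∇_x ∇_y z + ∇_y ∇_x z + ∇_{[x, y]} z`. -/
def curv (x y z : X) : X :=
  -N.nabla x (N.nabla y z) + N.nabla y (N.nabla x z) + N.nabla (N.nabla x y - N.nabla y x) z

/-- The covariant derivative of the curvature. -/
def nablaCurv (x y z w : X) : X :=
  N.nabla x (N.curv y z w) - N.curv (N.nabla x y) z w - N.curv y (N.nabla x z) w
    - N.curv y z (N.nabla x w)

/-- The exterior derivative of a `1`-form. -/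
def extDer (A : X → R) (x y : X) : R :=
  (N.der x (A y) - A (N.nabla x y)) - (N.der y (A x) - A (N.nabla y x))

theorem curv_add_left (x x' y z : X) : N.curv (x + x') y z = N.curv x y z + N.curv x' y z := by
  simp only [curv, map_add, map_sub, AddMonoidHom.add_apply, AddMonoidHom.sub_apply]; abel

theorem curv_add_middle (x y y' z : X) : N.curv x (y + y') z = N.curv x y z + N.curv x y' z := by
  simp only [curv, map_add, map_sub, AddMonoidHom.add_apply, AddMonoidHom.sub_apply]; abel

theorem curv_add_right (x y z z' : X) : N.curv x y (z + z') = N.curv x y z + N.curv x y z' := by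
  simp only [curv, map_add, map_sub]; abel

theorem curv_swap (x y z : X) : N.curv x y z = -N.curv y x z := by
  simp only [curv, map_sub, AddMonoidHom.sub_apply]; abel

/-- After regrouping, the cyclic sum is minus the Jacobi expression for the bracket `∇_x y - ∇_y x`;
torsion-freeness is built into that bracket. -/
theorem first_bianchi (x y z : X) : N.curv x y z + N.curv y z x + N.curv z x y = 0 := by
  have h := N.jacobi x y z
  simp only [curv, map_sub, AddMonoidHom.sub_apply] at h ⊢
  rw [← sub_eq_zero] at h
  rw [← neg_eq_zero, ← h]
  abel

/-- Third-order terms cancel as in the Jacobi identity for commutators of the operators `∇_x`; what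
survives is the derivative of `w` along the Jacobi relation. -/
theorem second_bianchi (x y z w : X) :
    N.nablaCurv x y z w + N.nablaCurv y z x w + N.nablaCurv z x y w = 0 := by
  have h := congrArg (fun v ↦ N.nabla v w) (N.jacobi x y z)
  simp only [nablaCurv, curv, map_sub, map_add, map_neg, AddMonoidHom.sub_apply,
    AddMonoidHom.add_apply] at h ⊢
  rw [← sub_eq_zero] at h
  rw [← h]
  abel

theorem curv_smul_left (f : R) (x y z : X) : N.curv (f • x) y z = f • N.curv x y z := by
  simp only [curv, map_sub, map_add, AddMonoidHom.sub_apply, AddMonoidHom.add_apply,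
    nabla_smul_left, nabla_smul]
  module

theorem curv_smul_middle (f : R) (x y z : X) : N.curv x (f • y) z = f • N.curv x y z := by
  rw [curv_swap, curv_smul_left, curv_swap N y]; module

/-- A direct expansion would need the bracket to act on functions as the commutator of derivations,
which is not an axiom here. The first Bianchi identity transfers linearity from the first two slots
instead; `der_bracket` then follows as a consequence. -/
theorem curv_smul_right (f : R) (x y z : X) : N.curv x y (f • z) = f • N.curv x y z := by
  have h1 := N.first_bianchi x y (f • z)
  have h2 := congrArg (f • ·) (N.first_bianchi x y z)
  simp only [smul_add, smul_zero] at h2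
  rw [curv_smul_middle, curv_smul_left, ← h2] at h1
  simpa using h1

/-- A parallel field is annihilated by the curvature. -/
theorem curv_of_parallel {e : X} (he : ∀ x, N.nabla x e = 0) (x y : X) : N.curv x y e = 0 := by
  simp [curv, he]

/-- If there is a parallel field on which multiplication by functions is faithful, the bracket acts
on functions as the commutator of derivations. -/
theorem der_bracket {e : X} (he : ∀ x, N.nabla x e = 0) (hf : ∀ f : R, f • e = 0 → f = 0)
    (f : R) (x y : X) :
    N.der x (N.der y f) - N.der y (N.der x f) = N.der (N.nabla x y - N.nabla y x) f := by
  have h := N.curv_smul_right f x y e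
  rw [N.curv_of_parallel he, smul_zero, curv] at h
  simp only [nabla_smul, he, smul_zero, add_zero] at h
  rw [← sub_eq_zero]
  apply hf
  rw [← neg_eq_zero, ← h]
  module

/-- The curvature of a metric covariant derivative is skew-symmetric. -/
theorem curv_skew {e : X} (he : ∀ x, N.nabla x e = 0) (hf : ∀ f : R, f • e = 0 → f = 0)
    (g : X →+ X →+ R)
    (hg : ∀ x y z, N.der x (g y z) = g (N.nabla x y) z + g y (N.nabla x z)) (x y z w : X) :
    g (N.curv x y z) w = -g z (N.curv x y w) := by
  have h := N.der_bracket he hf (g z w) x y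
  simp only [hg, map_add, map_sub, curv, map_neg, AddMonoidHom.sub_apply, AddMonoidHom.add_apply,
    AddMonoidHom.neg_apply] at h ⊢
  linear_combination (-1 : R) * h

/-- The Ricci identity for a recurrent curvature. -/
theorem curv_act_of_recurrent (A : X → R)
    (hA : ∀ x y z w, N.nablaCurv x y z w = A x • N.curv y z w) (x y u v w : X) :
    N.curv x y (N.curv u v w) - N.curv (N.curv x y u) v w - N.curv u (N.curv x y v) w
      - N.curv u v (N.curv x y w) = -(N.extDer A x y • N.curv u v w) := by
  have key : ∀ p a b c, N.nabla p (N.curv a b c) = A p • N.curv a b c + N.curv (N.nabla p a) b c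
      + N.curv a (N.nabla p b) c + N.curv a b (N.nabla p c) := by
    intro p a b c
    rw [← hA, nablaCurv]; abel
  have e1 : ∀ a b c d, N.curv (a - b) c d = N.curv a c d - N.curv b c d := by
    intro a b c d
    simp only [curv, map_sub, AddMonoidHom.sub_apply]; abel
  -- The bracket term is split into `∇_{∇_x y}` and `∇_{∇_y x}` because `A` is not assumed additive
  -- and `extDer` contains `A` at each of the two arguments separately.
  have exp : ∀ a, N.curv x y a = -N.nabla x (N.nabla y a) + N.nabla y (N.nabla x a)
      + N.nabla (N.nabla x y) a - N.nabla (N.nabla y x) a := by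
    intro a
    simp only [curv, map_sub, AddMonoidHom.sub_apply]; abel
  have l : ∀ a b c d, N.curv (-a + b + c - d) v w = -N.curv a v w + N.curv b v w + N.curv c v w
      - N.curv d v w := by
    intro a b c d
    simp only [curv, map_sub, map_add, map_neg, AddMonoidHom.sub_apply, AddMonoidHom.add_apply,
      AddMonoidHom.neg_apply]; abel
  have m : ∀ a b c d, N.curv u (-a + b + c - d) w = -N.curv u a w + N.curv u b w + N.curv u c w
      - N.curv u d w := by
    intro a b c d
    simp only [curv, map_sub, map_add, map_neg, AddMonoidHom.sub_apply, AddMonoidHom.add_apply,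
      AddMonoidHom.neg_apply]; abel
  have r : ∀ a b c d, N.curv u v (-a + b + c - d) = -N.curv u v a + N.curv u v b + N.curv u v c
      - N.curv u v d := by
    intro a b c d
    simp only [curv, map_sub, map_add, map_neg]; abel
  -- After the Leibniz rule `key` is applied twice, the terms `A x * A y` and the mixed first-order
  -- terms cancel by symmetry; only the derivatives of `A` remain.
  rw [exp (N.curv u v w), exp u, exp v, exp w, l, m, r]
  simp only [key, map_add, nabla_smul, extDer]
  module

end CovCalculus

end Calculus


/-! ### The slit bundle, `π`-vector fields and cut-off frames -/

section Sections

variable {E : Type*} [NormedAddCommGroup E] [NormedSpace ℝ E]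
  {M : Type*} [TopologicalSpace M] [ChartedSpace E M] [IsManifold 𝓘(ℝ, E) ∞ M]

/-- In a local trivialization a vector vanishes exactly when its fibre coordinate does, and that
coordinate is continuous. -/
theorem isOpen_slit : IsOpen (slit E M) := by
  rw [isOpen_iff_mem_nhds]
  intro u hu
  let e := trivializationAt E (TangentSpace 𝓘(ℝ, E) : M → Type _) u.proj
  have hue : u ∈ e.source := FiberBundle.mem_trivializationAt_proj_source
  have hc : ContinuousAt (fun w ↦ (e w).2) u :=
    continuous_snd.continuousAt.comp (e.continuousAt hue)
  have key : ∀ w ∈ e.source, ((e w).2 = 0 ↔ w.snd = 0) := by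
    intro w hw
    have hw' : w.proj ∈ e.baseSet := e.mem_source.1 hw
    rw [show (e w).2 = e.continuousLinearEquivAt ℝ w.proj hw' w.snd from rfl]
    exact map_eq_zero_iff _ (e.continuousLinearEquivAt ℝ w.proj hw').injective
  have h0 : (e u).2 ≠ 0 := fun h ↦ hu ((key u hue).1 h)
  filter_upwards [hc.eventually_ne h0, e.open_source.mem_nhds hue] with w hw hws
  exact fun h ↦ hw ((key w hws).2 h)

theorem isPiVectorField_iff {X : Π u : TangentBundle 𝓘(ℝ, E) M, PB E M u} :
    IsPiVectorField X ↔ ∀ u ∈ slit E M, ContMDiffAt 𝓘(ℝ, E).tangent 𝓘(ℝ, E) ∞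
      (fun w : TangentBundle 𝓘(ℝ, E) M ↦ (trivializationAt E (TangentSpace 𝓘(ℝ, E) : M → Type _) u.proj
        ⟨w.proj, X w⟩).2) u := by
  refine ⟨fun h u hu ↦ ?_, fun h u hu ↦ ?_⟩
  · exact (contMDiffAt_section u).1 (h.contMDiffAt (isOpen_slit.mem_nhds hu))
  · exact ((contMDiffAt_section u).2 (h u hu)).contMDiffWithinAt

theorem isPiVectorField_eta : IsPiVectorField (eta : Π u : TangentBundle 𝓘(ℝ, E) M, PB E M u) := by
  rw [isPiVectorField_iff]
  intro u hu
  have h := (contMDiffAt_totalSpace (n := ∞) (IM := 𝓘(ℝ, E).tangent) (f := fun w : TangentBundle 𝓘(ℝ, E) M ↦ w) (x₀ := u)).1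
    contMDiffAt_id
  exact h.2


theorem IsPiVectorField.contMDiffAt {X : Π u : TangentBundle 𝓘(ℝ, E) M, PB E M u}
    (hX : IsPiVectorField X) {u : TangentBundle 𝓘(ℝ, E) M} (hu : u ∈ slit E M) :
    ContMDiffAt 𝓘(ℝ, E).tangent (𝓘(ℝ, E).tangent.prod 𝓘(ℝ, E)) ∞
      (fun w ↦ TotalSpace.mk' E w (X w)) u :=
  ContMDiffOn.contMDiffAt hX (isOpen_slit.mem_nhds hu)

theorem IsPiVectorField.mdifferentiableAt {X : Π u : TangentBundle 𝓘(ℝ, E) M, PB E M u}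
    (hX : IsPiVectorField X) {u : TangentBundle 𝓘(ℝ, E) M} (hu : u ∈ slit E M) :
    MDifferentiableAt 𝓘(ℝ, E).tangent (𝓘(ℝ, E).tangent.prod 𝓘(ℝ, E))
      (fun w ↦ TotalSpace.mk' E w (X w)) u :=
  (hX.contMDiffAt hu).mdifferentiableAt (by simp)

theorem IsPiVectorField.congr {X Y : Π u : TangentBundle 𝓘(ℝ, E) M, PB E M u}
    (hX : IsPiVectorField X) (h : ∀ u ∈ slit E M, Y u = X u) : IsPiVectorField Y :=
  ContMDiffOn.congr hX fun u hu ↦ by rw [h u hu]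

theorem IsPiVectorField.add {X Y : Π u : TangentBundle 𝓘(ℝ, E) M, PB E M u}
    (hX : IsPiVectorField X) (hY : IsPiVectorField Y) : IsPiVectorField (X + Y) :=
  ContMDiffOn.add_section hX hY

theorem IsPiVectorField.neg {X : Π u : TangentBundle 𝓘(ℝ, E) M, PB E M u}
    (hX : IsPiVectorField X) : IsPiVectorField (-X) :=
  ContMDiffOn.neg_section hX

theorem IsPiVectorField.sub {X Y : Π u : TangentBundle 𝓘(ℝ, E) M, PB E M u}
    (hX : IsPiVectorField X) (hY : IsPiVectorField Y) : IsPiVectorField (X - Y) :=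
  ContMDiffOn.sub_section hX hY

theorem IsPiVectorField.smul {f : TangentBundle 𝓘(ℝ, E) M → ℝ}
    {X : Π u : TangentBundle 𝓘(ℝ, E) M, PB E M u}
    (hf : ContMDiffOn 𝓘(ℝ, E).tangent 𝓘(ℝ, ℝ) ∞ f (slit E M)) (hX : IsPiVectorField X) :
    IsPiVectorField (f • X) :=
  ContMDiffOn.smul_section hf hX

theorem isPiVectorField_zero :
    IsPiVectorField (0 : Π u : TangentBundle 𝓘(ℝ, E) M, PB E M u) :=
  (contMDiff_zeroSection ℝ (PB E M)).contMDiffOn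

open Module in
/-- Near every point there is a frame of globally defined `π`-vector fields, in which every
`π`-vector field has smooth coefficients after multiplication by a cut-off function. -/
theorem exists_frame [FiniteDimensional ℝ E] [T2Space M] (u : TangentBundle 𝓘(ℝ, E) M) :
    ∃ (s : Fin (finrank ℝ E) → Π w : TangentBundle 𝓘(ℝ, E) M, PB E M w)
      (b : Basis (Fin (finrank ℝ E)) ℝ (PB E M u)) (ψ : TangentBundle 𝓘(ℝ, E) M → ℝ),
      (∀ i, IsPiVectorField (s i)) ∧ (∀ i, s i u = b i) ∧ ψ u = 1 ∧
      ContMDiffOn 𝓘(ℝ, E).tangent 𝓘(ℝ, ℝ) ∞ ψ (slit E M) ∧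
      ∀ X, IsPiVectorField X → ∃ c : Fin (finrank ℝ E) → TangentBundle 𝓘(ℝ, E) M → ℝ,
        (∀ i, ContMDiffOn 𝓘(ℝ, E).tangent 𝓘(ℝ, ℝ) ∞ (c i) (slit E M)) ∧
        ∀ w, ψ w • X w = ∑ i, c i w • s i w := by
  let e := trivializationAt E (PB E M) u
  have hue : u ∈ e.baseSet := FiberBundle.mem_baseSet_trivializationAt' u
  let b₀ := finBasis ℝ E
  let φ : SmoothBumpFunction 𝓘(ℝ, E) u.proj := Classical.choice inferInstance
  let χ : TangentBundle 𝓘(ℝ, E) M → ℝ := fun w ↦ φ w.proj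
  have hχ : ContMDiff 𝓘(ℝ, E).tangent 𝓘(ℝ, ℝ) ∞ χ := φ.contMDiff.comp (contMDiff_proj _)
  have hsupp : tsupport χ ⊆ e.baseSet := by
    intro w hw
    have h1 : w.proj ∈ tsupport φ :=
      tsupport_comp_subset_preimage φ (contMDiff_proj (n := ∞) (IB := 𝓘(ℝ, E)) (TangentSpace 𝓘(ℝ, E) : M → Type _)).continuous hw
    exact φ.tsupport_subset_chartAt_source h1
  have hχu : χ u = 1 := φ.eq_one
  -- Both the frame and the coefficients need a factor `χ` to be extended by zero outside the
  -- trivialization, so the total cut-off is `χ * χ`.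
  refine ⟨fun i ↦ χ • e.localFrame b₀ i, e.basisAt b₀ hue, χ * χ, fun i ↦ ?_, fun i ↦ ?_, ?_,
    (hχ.mul hχ).contMDiffOn, fun X hX ↦ ?_⟩
  · exact (ContMDiffOn.smul_section_of_tsupport hχ.contMDiffOn e.open_baseSet hsupp
      (e.contMDiffOn_localFrame_baseSet ∞ b₀ i)).contMDiffOn
  · simp [hχu, hue]
  · simp [hχu]
  · refine ⟨fun i w ↦ χ w * e.localFrameCoeff 𝓘(ℝ, E).tangent b₀ i w (X w), fun i ↦ ?_, fun w ↦ ?_⟩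
    · intro w hw
      by_cases hwe : w ∈ e.baseSet
      · exact (hχ.contMDiffAt.mul (contMDiffAt_localFrameCoeff b₀ hwe
          (hX.contMDiffAt hw) i)).contMDiffWithinAt
      · have hw' : w ∈ (tsupport χ)ᶜ := fun h ↦ hwe (hsupp h)
        refine (contMDiffAt_const (c := (0 : ℝ))).contMDiffWithinAt.congr_of_eventuallyEq ?_ ?_
        · filter_upwards [mem_nhdsWithin_of_mem_nhds
            ((isClosed_tsupport χ).isOpen_compl.mem_nhds hw')] with z hz
          simp [image_eq_zero_of_notMem_tsupport hz]
        · simp [image_eq_zero_of_notMem_tsupport hw']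
    · by_cases hwe : w ∈ e.baseSet
      · conv_lhs => rw [e.eq_sum_localFrameCoeff_smul (I := 𝓘(ℝ, E).tangent) (b := b₀) (s := X) hwe]
        rw [Finset.smul_sum]
        refine Finset.sum_congr rfl fun i _ ↦ ?_
        simp only [Pi.mul_apply, Pi.smul_apply', smul_smul]
        congr 1; ring
      · have : χ w = 0 := image_eq_zero_of_notMem_tsupport fun h ↦ hwe (hsupp h)
        simp [this]

/-- Every vector of a fibre is the value of a `π`-vector field. -/
theorem exists_isPiVectorField_eq [FiniteDimensional ℝ E] [T2Space M]
    (u : TangentBundle 𝓘(ℝ, E) M) (v : PB E M u) :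
    ∃ X : Π w : TangentBundle 𝓘(ℝ, E) M, PB E M w, IsPiVectorField X ∧ X u = v := by
  obtain ⟨s, b, -, hs, hsb, -⟩ := exists_frame u
  refine ⟨fun w ↦ ∑ i, b.repr v i • s i w, ?_, ?_⟩
  · exact ContMDiffOn.sum_section fun i _ ↦ (hs i).const_smul_section
  · simp only [hsb, b.sum_repr]

end Sections

/-! ### Smoothness of horizontal lifts and of the h-covariant derivative -/

section Horizontal

variable {E : Type*} [NormedAddCommGroup E] [NormedSpace ℝ E]
  {M : Type*} [TopologicalSpace M] [ChartedSpace E M] [IsManifold 𝓘(ℝ, E) ∞ M]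

theorem contMDiffAt_rho (u : TangentBundle 𝓘(ℝ, E) M) :
    ContMDiffAt 𝓘(ℝ, E).tangent 𝓘(ℝ, (E × E) →L[ℝ] E) ∞
      (fun w : TangentBundle 𝓘(ℝ, E) M ↦ ContinuousLinearMap.inCoordinates (E × E)
        (TangentSpace 𝓘(ℝ, E).tangent) E (PB E M) u w u w (rho w)) u := by
  have h := ContMDiffAt.mfderiv_const (n := ∞) (m := ∞) (x₀ := u)
    (tangentProj E M).contMDiff.contMDiffAt (by simp)
  refine h.congr_of_eventuallyEq (Filter.Eventually.of_forall fun w ↦ ?_)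
  rfl

theorem contMDiffAt_connection {D : Conn E M} (hD : IsLinearConnection D)
    {X : Π u : TangentBundle 𝓘(ℝ, E) M, PB E M u} (hX : IsPiVectorField X)
    {u : TangentBundle 𝓘(ℝ, E) M} (hu : u ∈ slit E M) :
    ContMDiffAt 𝓘(ℝ, E).tangent 𝓘(ℝ, (E × E) →L[ℝ] E) ∞
      (fun w : TangentBundle 𝓘(ℝ, E) M ↦ ContinuousLinearMap.inCoordinates (E × E)
        (TangentSpace 𝓘(ℝ, E).tangent) E (PB E M) u w u w (D X w)) u :=
  ((contMDiffAt_hom_bundle _).1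
    ((hD.smooth.contMDiff hX).contMDiffAt (isOpen_slit.mem_nhds hu))).2

/-- The lift is `(ρ, K)⁻¹(X, 0)`. In coordinates `(ρ, K)` is a smooth family of operators, `K = Dη`
being smooth because `η` is a `π`-vector field, and operator inversion is smooth near an invertible
operator. -/
theorem isVectorField_hLift [FiniteDimensional ℝ E] {D : Conn E M} (hD : IsLinearConnection D) (hreg : IsRegular D)
    {X : Π u : TangentBundle 𝓘(ℝ, E) M, PB E M u} (hX : IsPiVectorField X) :
    IsVectorField (hLift D X) := by
  intro u hu
  refine ContMDiffAt.contMDiffWithinAt ((contMDiffAt_section u).2 ?_)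
  let a := trivializationAt (E × E) (TangentSpace 𝓘(ℝ, E).tangent) u
  let c := trivializationAt E (PB E M) u
  have hua : u ∈ a.baseSet := FiberBundle.mem_baseSet_trivializationAt' u
  have huc : u ∈ c.baseSet := FiberBundle.mem_baseSet_trivializationAt' u
  let Φ : TangentBundle 𝓘(ℝ, E) M → (E × E) →L[ℝ] (E × E) := fun w ↦
    (ContinuousLinearMap.inCoordinates (E × E)
        (TangentSpace 𝓘(ℝ, E).tangent) E (PB E M) u w u w (rho w)).prod
    (ContinuousLinearMap.inCoordinates (E × E)
        (TangentSpace 𝓘(ℝ, E).tangent) E (PB E M) u w u w (connMap D w))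
  have hΦ : ContMDiffAt 𝓘(ℝ, E).tangent 𝓘(ℝ, (E × E) →L[ℝ] (E × E)) ∞ Φ u := by
    have h := (contMDiffAt_rho u).prodMk_space
      (contMDiffAt_connection hD isPiVectorField_eta hu)
    exact (ContinuousLinearMap.prodₗᵢ ℝ (E := E × E) (F := E) (G := E)
      (𝕜 := ℝ)).toContinuousLinearEquiv.contDiff.contMDiff.contMDiffAt.comp u h
  have hinv : ∀ w (hwa : w ∈ a.baseSet) (hwc : w ∈ c.baseSet), w ∈ slit E M →
      ∃ e : (E × E) ≃L[ℝ] (E × E), (e : (E × E) →L[ℝ] (E × E)) = Φ w ∧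
        ∀ v : PB E M w, e (a ⟨w, beta D w v⟩).2 = ((c ⟨w, v⟩).2, 0) := by
    intro w hwa hwc hw
    obtain ⟨f, hf⟩ := isInvertible_rho_prod_connMap hreg hw
    let ae := a.continuousLinearEquivAt ℝ w hwa
    let ce := c.continuousLinearEquivAt ℝ w hwc
    have hΦw : ∀ x, Φ w x = (ce (rho w (ae.symm x)), ce (connMap D w (ae.symm x))) := by
      intro x
      simp only [Φ, ContinuousLinearMap.inCoordinates_eq hwa hwc]
      rfl
    refine ⟨ae.symm.trans (f.trans (ce.prodCongr ce)), ?_, fun v ↦ ?_⟩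
    · refine ContinuousLinearMap.ext fun x ↦ ?_
      rw [hΦw]
      have := congrArg (fun g ↦ g (ae.symm x)) hf
      exact congrArg (ce.prodCongr ce) this
    · have h1 : (a ⟨w, beta D w v⟩).2 = ae (beta D w v) := rfl
      have h2 : f (beta D w v) = (v, 0) := by
        have := congrArg (fun g ↦ g (beta D w v)) hf
        refine this.trans ?_
        exact Prod.ext (rho_beta hreg hw v) (beta_mem_horizontal hreg hw v)
      rw [h1]
      change (ce.prodCongr ce) (f (ae.symm (ae (beta D w v)))) = _
      rw [ae.symm_apply_apply, h2]
      exact Prod.ext rfl (map_zero ce)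
  obtain ⟨e₀, he₀, -⟩ := hinv u hua huc hu
  have hΦinv : ContMDiffAt 𝓘(ℝ, E).tangent 𝓘(ℝ, (E × E) →L[ℝ] (E × E)) ∞
      (fun w ↦ (Φ w).inverse) u := by
    have : CompleteSpace (E × E) := FiniteDimensional.complete ℝ _
    have h := contDiffAt_map_inverse (n := ∞) e₀
    rw [he₀] at h
    exact h.contMDiffAt.comp u hΦ
  have hcX := (isPiVectorField_iff.1 hX u hu)
  refine (hΦinv.clm_apply (hcX.prodMk_space (contMDiffAt_const (c := (0 : E))))).congr_of_eventuallyEq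
    ?_
  filter_upwards [a.open_baseSet.mem_nhds hua, c.open_baseSet.mem_nhds huc,
    isOpen_slit.mem_nhds hu] with w hwa hwc hw
  obtain ⟨e, he, hev⟩ := hinv w hwa hwc hw
  rw [← he, ContinuousLinearMap.inverse_equiv]
  have := hev (X w)
  rw [← e.eq_symm_apply] at this
  exact this

theorem isPiVectorField_hCov [FiniteDimensional ℝ E] {D : Conn E M} (hD : IsLinearConnection D) (hreg : IsRegular D)
    {X Y : Π u : TangentBundle 𝓘(ℝ, E) M, PB E M u} (hX : IsPiVectorField X)
    (hY : IsPiVectorField Y) : IsPiVectorField (hCov D X Y) :=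
  ContMDiffOn.clm_bundle_apply (hD.smooth.contMDiff hY) (isVectorField_hLift hD hreg hX)

/-- A connection is local and `𝒯M` is open, so values on the zero section have no influence. -/
theorem connection_congr {D : Conn E M} (hD : IsLinearConnection D)
    {X Y : Π u : TangentBundle 𝓘(ℝ, E) M, PB E M u} (hX : IsPiVectorField X)
    (h : ∀ u ∈ slit E M, Y u = X u) {u : TangentBundle 𝓘(ℝ, E) M} (hu : u ∈ slit E M) :
    D Y u = D X u :=
  hD.isCovariantDerivativeOn.congr_of_eqOn ((hX.congr h).mdifferentiableAt hu)
    (hX.mdifferentiableAt hu) (isOpen_slit.mem_nhds hu) h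

end Horizontal


/-! ### The Finsler metric as a smooth symmetric bilinear form -/

section Metric

/-- The metric is defined by iterated one-variable derivatives; the chain rule along lines turns
these into a second Fréchet derivative, from which bilinearity, symmetry and smoothness are read
off. -/
theorem deriv_deriv_eq_fderiv_fderiv {V : Type*} [NormedAddCommGroup V] [NormedSpace ℝ V]
    {F : V → ℝ} {q : V} (hF : ContDiffAt ℝ 2 F q) (a b : V) :
    deriv (fun s : ℝ ↦ deriv (fun t : ℝ ↦ F (q + s • a + t • b)) 0) 0 =
      fderiv ℝ (fderiv ℝ F) q a b := by
  have hline : ∀ (p c : V) (t : ℝ), HasDerivAt (fun t : ℝ ↦ p + t • c) c t := fun p c t ↦ by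
    simpa using ((hasDerivAt_id t).smul_const c).const_add p
  have hev : ∀ᶠ x in nhds q, DifferentiableAt ℝ F x := by
    filter_upwards [hF.eventually (by simp)] with x hx
    exact hx.differentiableAt (by simp)
  have hcont : Filter.Tendsto (fun s : ℝ ↦ q + s • a) (nhds 0) (nhds q) := by
    have := (hline q a 0).continuousAt.tendsto
    simpa using this
  have h1 : (fun s : ℝ ↦ deriv (fun t : ℝ ↦ F (q + s • a + t • b)) 0) =ᶠ[nhds 0]
      fun s ↦ fderiv ℝ F (q + s • a) b := by
    filter_upwards [hcont.eventually hev] with s hs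
    have hs' : HasFDerivAt F (fderiv ℝ F (q + s • a)) (q + s • a + (0 : ℝ) • b) := by
      simpa using hs.hasFDerivAt
    exact (hs'.comp_hasDerivAt (0 : ℝ) (hline (q + s • a) b 0)).deriv
  rw [h1.deriv_eq]
  have h2 : HasFDerivAt (fderiv ℝ F) (fderiv ℝ (fderiv ℝ F) q) (q + (0 : ℝ) • a) := by
    simpa using ((hF.fderiv_right (m := 1) (by norm_num)).differentiableAt (by simp)).hasFDerivAt
  have h3 := h2.comp_hasDerivAt (0 : ℝ) (hline q a 0)
  exact (h3.clm_apply (hasDerivAt_const (0 : ℝ) b)).deriv.trans (by simp)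

variable {E : Type*} [NormedAddCommGroup E] [NormedSpace ℝ E]
  {M : Type*} [TopologicalSpace M] [ChartedSpace E M] [IsManifold 𝓘(ℝ, E) ∞ M]

/-- The function `L² / 2` read in the chart of `TM` at `u`. -/
noncomputable def energyInChart (L : TangentBundle 𝓘(ℝ, E) M → ℝ) (u : TangentBundle 𝓘(ℝ, E) M) (p : E × E) : ℝ :=
  (1 / 2 : ℝ) * L ((extChartAt 𝓘(ℝ, E).tangent u).symm p) ^ 2

theorem contDiffAt_energyInChart {L : TangentBundle 𝓘(ℝ, E) M → ℝ} (hL : IsFinslerStructure L)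
    (u : TangentBundle 𝓘(ℝ, E) M) {w : TangentBundle 𝓘(ℝ, E) M}
    (hw : w ∈ (extChartAt 𝓘(ℝ, E).tangent u).source) (hws : w ∈ slit E M) :
    ContDiffAt ℝ ∞ (energyInChart L u) (extChartAt 𝓘(ℝ, E).tangent u w) := by
  rw [← contMDiffAt_iff_contDiffAt]
  have h1 := (contMDiffOn_extChartAt_symm (I := 𝓘(ℝ, E).tangent) (n := ∞) u).contMDiffAt
    ((isOpen_extChartAt_target u).mem_nhds ((extChartAt 𝓘(ℝ, E).tangent u).map_source hw))
  have h2 := hL.smooth.contMDiffAt (isOpen_slit.mem_nhds hws)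
  rw [← (extChartAt 𝓘(ℝ, E).tangent u).left_inv hw] at h2
  have h3 : ContMDiffAt 𝓘(ℝ, E × E) 𝓘(ℝ, ℝ) ∞ (fun p ↦ L ((extChartAt 𝓘(ℝ, E).tangent u).symm p))
    (extChartAt 𝓘(ℝ, E).tangent u w) := h2.comp _ h1
  exact contMDiffAt_const.mul (h3.pow 2)

/-- The coordinates of a vector of the fibre over `w` in the chart at `u`. -/
noncomputable def fiberCoord (u w : TangentBundle 𝓘(ℝ, E) M) (v : TangentSpace 𝓘(ℝ, E) w.proj) : E :=
  (trivializationAt E (TangentSpace 𝓘(ℝ, E) : M → Type _) u.proj ⟨w.proj, v⟩).2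

theorem exists_linearEquiv_fiberCoord {u w : TangentBundle 𝓘(ℝ, E) M}
    (hw : w.proj ∈ (trivializationAt E (TangentSpace 𝓘(ℝ, E) : M → Type _) u.proj).baseSet) :
    ∃ e : TangentSpace 𝓘(ℝ, E) w.proj ≃ₗ[ℝ] E, ∀ v, e v = fiberCoord u w v :=
  ⟨((trivializationAt E (TangentSpace 𝓘(ℝ, E) : M → Type _) u.proj).continuousLinearEquivAt ℝ
    w.proj hw).toLinearEquiv, fun _ ↦ rfl⟩

theorem mem_extChartAt_source_iff (u w : TangentBundle 𝓘(ℝ, E) M) :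
    w ∈ (extChartAt 𝓘(ℝ, E).tangent u).source ↔
      w.proj ∈ (trivializationAt E (TangentSpace 𝓘(ℝ, E) : M → Type _) u.proj).baseSet := by
  rw [extChartAt_source, TangentBundle.mem_chart_source_iff]
  rfl

/-- The chart of `TM` is linear on fibres, so a vertical translation moves only the second
coordinate. -/
theorem extChartAt_add_smul (u w : TangentBundle 𝓘(ℝ, E) M)
    (hw : w ∈ (extChartAt 𝓘(ℝ, E).tangent u).source) (v : TangentSpace 𝓘(ℝ, E) w.proj) :
    extChartAt 𝓘(ℝ, E).tangent u ⟨w.proj, w.snd + v⟩ =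
      extChartAt 𝓘(ℝ, E).tangent u w + (0, fiberCoord u w v) := by
  obtain ⟨e, he⟩ := exists_linearEquiv_fiberCoord ((mem_extChartAt_source_iff u w).1 hw)
  have key : ∀ y : TangentSpace 𝓘(ℝ, E) w.proj, extChartAt 𝓘(ℝ, E).tangent u ⟨w.proj, y⟩ =
      (extChartAt 𝓘(ℝ, E) u.proj w.proj, fiberCoord u w y) := by
    intro y
    rw [FiberBundle.extChartAt]
    rfl
  rw [key]
  refine Eq.trans ?_ (congrArg (· + ((0 : E), fiberCoord u w v)) (key w.snd).symm)
  ext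
  · simp
  · simp only [Prod.mk_add_mk, ← he]
    exact map_add e _ _

theorem metric_eq_fderiv_fderiv {L : TangentBundle 𝓘(ℝ, E) M → ℝ} (hL : IsFinslerStructure L)
    (u : TangentBundle 𝓘(ℝ, E) M) {w : TangentBundle 𝓘(ℝ, E) M}
    (hw : w ∈ (extChartAt 𝓘(ℝ, E).tangent u).source) (hws : w ∈ slit E M) (v z : TangentSpace 𝓘(ℝ, E) w.proj) :
    metric L w v z = fderiv ℝ (fderiv ℝ (energyInChart L u)) (extChartAt 𝓘(ℝ, E).tangent u w)
      (0, fiberCoord u w v) (0, fiberCoord u w z) := by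
  rw [← deriv_deriv_eq_fderiv_fderiv ((contDiffAt_energyInChart hL u hw hws).of_le (by norm_cast))]
  obtain ⟨e, he⟩ := exists_linearEquiv_fiberCoord ((mem_extChartAt_source_iff u w).1 hw)
  unfold metric energyInChart
  congr! 7 with s t
  have h := extChartAt_add_smul u w hw (s • v + t • z)
  have h' : extChartAt 𝓘(ℝ, E).tangent u w + s • ((0 : E), fiberCoord u w v)
      + t • ((0 : E), fiberCoord u w z) =
      extChartAt 𝓘(ℝ, E).tangent u ⟨w.proj, w.snd + (s • v + t • z)⟩ := by
    rw [h, ← he, ← he, ← he, map_add, map_smul, map_smul, add_assoc]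
    congr 1
    ext <;> simp
  rw [h', PartialEquiv.left_inv]
  · rw [← add_assoc]
  · rw [mem_extChartAt_source_iff] at hw ⊢
    exact hw

theorem contMDiffOn_metric {L : TangentBundle 𝓘(ℝ, E) M → ℝ} (hL : IsFinslerStructure L)
    {Y Z : Π u : TangentBundle 𝓘(ℝ, E) M, PB E M u} (hY : IsPiVectorField Y)
    (hZ : IsPiVectorField Z) :
    ContMDiffOn 𝓘(ℝ, E).tangent 𝓘(ℝ, ℝ) ∞ (fun w ↦ metric L w (Y w) (Z w)) (slit E M) := by
  intro u hu
  refine ContMDiffAt.contMDiffWithinAt ?_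
  have hus := mem_extChartAt_source (I := 𝓘(ℝ, E).tangent) u
  have hF := contDiffAt_energyInChart hL u hus hu
  have hF2 : ContMDiffAt 𝓘(ℝ, E).tangent 𝓘(ℝ, (E × E) →L[ℝ] (E × E) →L[ℝ] ℝ) ∞
      (fun w ↦ fderiv ℝ (fderiv ℝ (energyInChart L u)) (extChartAt 𝓘(ℝ, E).tangent u w)) u :=
    ((hF.fderiv_right (m := ∞) (by simp)).fderiv_right (m := ∞) (by simp)).contMDiffAt.comp u
      (contMDiffAt_extChartAt (I := 𝓘(ℝ, E).tangent))
  have hc : ∀ {X : Π u : TangentBundle 𝓘(ℝ, E) M, PB E M u}, IsPiVectorField X →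
      ContMDiffAt 𝓘(ℝ, E).tangent 𝓘(ℝ, E × E) ∞ (fun w ↦ ((0 : E), fiberCoord u w (X w))) u :=
    fun hX ↦ (contMDiffAt_const (c := (0 : E))).prodMk_space (isPiVectorField_iff.1 hX u hu)
  refine ((hF2.clm_apply (hc hY)).clm_apply (hc hZ)).congr_of_eventuallyEq ?_
  filter_upwards [extChartAt_source_mem_nhds (I := 𝓘(ℝ, E).tangent) u, isOpen_slit.mem_nhds hu]
    with w hw hws
  exact metric_eq_fderiv_fderiv hL u hw hws _ _

/-- At a nonzero tangent vector the Finsler metric is a symmetric bilinear form. -/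
theorem exists_bilinForm_metric {L : TangentBundle 𝓘(ℝ, E) M → ℝ} (hL : IsFinslerStructure L)
    {u : TangentBundle 𝓘(ℝ, E) M} (hu : u ∈ slit E M) :
    ∃ B : LinearMap.BilinForm ℝ (PB E M u), (∀ v w, B v w = metric L u v w) ∧
      ∀ v w, B v w = B w v := by
  have hus := mem_extChartAt_source (I := 𝓘(ℝ, E).tangent) u
  obtain ⟨e, he⟩ := exists_linearEquiv_fiberCoord ((mem_extChartAt_source_iff u u).1 hus)
  let Q := fderiv ℝ (fderiv ℝ (energyInChart L u)) (extChartAt 𝓘(ℝ, E).tangent u u)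
  have hQ : ∀ v z, Q (0, e v) (0, e z) = metric L u v z := fun v z ↦ by
    rw [metric_eq_fderiv_fderiv hL u hus hu, he, he]
  have hsymm : IsSymmSndFDerivAt ℝ (energyInChart L u) (extChartAt 𝓘(ℝ, E).tangent u u) :=
    (contDiffAt_energyInChart hL u hus hu).isSymmSndFDerivAt
      (by rw [minSmoothness_of_isRCLikeNormedField]; norm_cast)
  let i : TangentSpace 𝓘(ℝ, E) u.proj →ₗ[ℝ] E × E := (LinearMap.inr ℝ E E).comp e.toLinearMap
  let Q' : LinearMap.BilinForm ℝ (E × E) :=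
    LinearMap.mk₂ ℝ (fun p q ↦ Q p q) (by simp) (by simp) (by simp) (by simp)
  exact ⟨Q'.compl₁₂ i i, hQ, fun v w ↦ hsymm _ _⟩

end Metric


/-! ### Rules of the h-covariant derivative; brackets of horizontal lifts -/

section Calculus

variable {E : Type*} [NormedAddCommGroup E] [NormedSpace ℝ E]
  {M : Type*} [TopologicalSpace M] [ChartedSpace E M] [IsManifold 𝓘(ℝ, E) ∞ M]

theorem beta_add (D : Conn E M) (u : TangentBundle 𝓘(ℝ, E) M) (v w : PB E M u) :
    beta D u (v + w) = beta D u v + beta D u w := by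
  unfold beta
  rw [← map_add, Prod.mk_add_mk, add_zero]

theorem beta_smul (D : Conn E M) (u : TangentBundle 𝓘(ℝ, E) M) (c : ℝ) (v : PB E M u) :
    beta D u (c • v) = c • beta D u v := by
  unfold beta
  rw [← map_smul, Prod.smul_mk, smul_zero]

theorem hCov_congr {D : Conn E M} (hD : IsLinearConnection D)
    {X X' Y Y' : Π u : TangentBundle 𝓘(ℝ, E) M, PB E M u} (hY : IsPiVectorField Y)
    {u : TangentBundle 𝓘(ℝ, E) M} (hu : u ∈ slit E M)
    (hXX' : X' u = X u) (hYY' : ∀ w ∈ slit E M, Y' w = Y w) :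
    hCov D X' Y' u = hCov D X Y u := by
  unfold hCov
  rw [connection_congr hD hY hYY' hu, hXX']

theorem hCov_add_left (D : Conn E M) (X X' Y : Π u : TangentBundle 𝓘(ℝ, E) M, PB E M u)
    (u : TangentBundle 𝓘(ℝ, E) M) :
    hCov D (X + X') Y u = hCov D X Y u + hCov D X' Y u := by
  unfold hCov
  rw [Pi.add_apply, beta_add, map_add]

theorem hCov_smul_left (D : Conn E M) (f : TangentBundle 𝓘(ℝ, E) M → ℝ)
    (X Y : Π u : TangentBundle 𝓘(ℝ, E) M, PB E M u) (u : TangentBundle 𝓘(ℝ, E) M) :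
    hCov D (f • X) Y u = f u • hCov D X Y u := by
  unfold hCov
  rw [Pi.smul_apply', beta_smul, map_smul]

theorem hCov_add_right {D : Conn E M} (hD : IsLinearConnection D)
    (X : Π u : TangentBundle 𝓘(ℝ, E) M, PB E M u)
    {Y Y' : Π u : TangentBundle 𝓘(ℝ, E) M, PB E M u} (hY : IsPiVectorField Y)
    (hY' : IsPiVectorField Y') {u : TangentBundle 𝓘(ℝ, E) M} (hu : u ∈ slit E M) :
    hCov D X (Y + Y') u = hCov D X Y u + hCov D X Y' u := by
  unfold hCov
  rw [hD.isCovariantDerivativeOn.add (hY.mdifferentiableAt hu) (hY'.mdifferentiableAt hu) hu,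
    add_apply]

theorem hCov_smul_right {D : Conn E M} (hD : IsLinearConnection D)
    (X : Π u : TangentBundle 𝓘(ℝ, E) M, PB E M u) {f : TangentBundle 𝓘(ℝ, E) M → ℝ}
    (hf : ContMDiffOn 𝓘(ℝ, E).tangent 𝓘(ℝ, ℝ) ∞ f (slit E M))
    {Y : Π u : TangentBundle 𝓘(ℝ, E) M, PB E M u} (hY : IsPiVectorField Y)
    {u : TangentBundle 𝓘(ℝ, E) M} (hu : u ∈ slit E M) :
    hCov D X (f • Y) u =
      mvfderiv 𝓘(ℝ, E).tangent f u (beta D u (X u)) • Y u + f u • hCov D X Y u := by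
  unfold hCov
  rw [hD.isCovariantDerivativeOn.leibniz (hY.mdifferentiableAt hu)
    ((hf.contMDiffAt (isOpen_slit.mem_nhds hu)).mdifferentiableAt (by simp)) hu, add_comm]
  rfl

/-- The fundamental `π`-vector field is horizontally parallel. -/
theorem hCov_eta [FiniteDimensional ℝ E] {D : Conn E M} (hreg : IsRegular D)
    (X : Π u : TangentBundle 𝓘(ℝ, E) M, PB E M u)
    {u : TangentBundle 𝓘(ℝ, E) M} (hu : u ∈ slit E M) : hCov D X eta u = 0 :=
  beta_mem_horizontal hreg hu (X u)

theorem metric_eta_pos {L : TangentBundle 𝓘(ℝ, E) M → ℝ} (hL : IsFinslerStructure L)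
    {u : TangentBundle 𝓘(ℝ, E) M} (hu : u ∈ slit E M) : 0 < metric L u (eta u) (eta u) :=
  hL.posDef u hu _ hu

/-- Since `η` is parallel, `∇_{βX}(fη) = ((βX)f) η`; hence `(βX)f = g(∇_{βX}(fη), η) / g(η, η)`, a
quotient of functions already known to be smooth. -/
theorem contMDiffOn_mvfderiv_beta [FiniteDimensional ℝ E] {L : TangentBundle 𝓘(ℝ, E) M → ℝ}
    (hL : IsFinslerStructure L)
    {D : Conn E M} (hD : IsLinearConnection D) (hreg : IsRegular D)
    {X : Π u : TangentBundle 𝓘(ℝ, E) M, PB E M u} (hX : IsPiVectorField X)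
    {f : TangentBundle 𝓘(ℝ, E) M → ℝ}
    (hf : ContMDiffOn 𝓘(ℝ, E).tangent 𝓘(ℝ, ℝ) ∞ f (slit E M)) :
    ContMDiffOn 𝓘(ℝ, E).tangent 𝓘(ℝ, ℝ) ∞
      (fun u ↦ mvfderiv 𝓘(ℝ, E).tangent f u (beta D u (X u))) (slit E M) := by
  have h1 := contMDiffOn_metric hL
    (isPiVectorField_hCov hD hreg hX (isPiVectorField_eta.smul hf)) isPiVectorField_eta
  have h2 := contMDiffOn_metric hL (isPiVectorField_eta (E := E) (M := M)) isPiVectorField_eta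
  refine (h1.div₀ h2 fun u hu ↦ (metric_eta_pos hL hu).ne').congr fun u hu ↦ ?_
  obtain ⟨B, hB, -⟩ := exists_bilinForm_metric hL hu
  have h : hCov D X (f • eta) u = mvfderiv 𝓘(ℝ, E).tangent f u (beta D u (X u)) • eta u := by
    rw [hCov_smul_right hD X hf isPiVectorField_eta hu, hCov_eta hreg X hu, smul_zero, add_zero]
  have h0 : B (eta u) (eta u) ≠ 0 := by
    rw [hB]; exact (metric_eta_pos hL hu).ne'
  have h3 : metric L u (hCov D X (f • eta) u) (eta u) / metric L u (eta u) (eta u) =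
      mvfderiv 𝓘(ℝ, E).tangent f u (beta D u (X u)) := by
    rw [← hB, ← hB, h, map_smul, LinearMap.smul_apply, smul_eq_mul, mul_div_assoc, div_self h0,
      mul_one]
  exact h3.symm

variable [FiniteDimensional ℝ E] {L : TangentBundle 𝓘(ℝ, E) M → ℝ} {D : Conn E M}

/-- Integrability makes the bracket horizontal, hence determined by its image under `ρ`; the
vanishing (h)h-torsion computes that image. -/
theorem mlieBracket_hLift (hD : IsCartanConnection L D) (hint : IsHorizontallyIntegrable D)
    {X Y : Π u : TangentBundle 𝓘(ℝ, E) M, PB E M u} (hX : IsPiVectorField X)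
    (hY : IsPiVectorField Y) {u : TangentBundle 𝓘(ℝ, E) M} (hu : u ∈ slit E M) :
    VectorField.mlieBracket 𝓘(ℝ, E).tangent (hLift D X) (hLift D Y) u =
      hLift D (hCov D X Y - hCov D Y X) u := by
  have hmem := hint (hLift D X) (hLift D Y) (isVectorField_hLift hD.linear hD.regular hX)
    (isVectorField_hLift hD.linear hD.regular hY)
    (fun w hw ↦ beta_mem_horizontal hD.regular hw _)
    (fun w hw ↦ beta_mem_horizontal hD.regular hw _) u hu
  have htor := hD.torsion_hh X Y hX hY u hu
  have hc : ∀ {Z : Π u : TangentBundle 𝓘(ℝ, E) M, PB E M u}, IsPiVectorField Z →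
      D (fun w ↦ rho w (hLift D Z w)) u = D Z u := fun hZ ↦
    connection_congr hD.linear hZ (fun w hw ↦ rho_beta hD.regular hw _) hu
  rw [torsion, hc hX, hc hY, sub_eq_zero] at htor
  rw [← beta_rho hD.regular hu _ hmem, ← htor]
  rfl

theorem hCurv_apply (hD : IsCartanConnection L D) (hint : IsHorizontallyIntegrable D)
    {X Y : Π u : TangentBundle 𝓘(ℝ, E) M, PB E M u} (hX : IsPiVectorField X)
    (hY : IsPiVectorField Y) (Z : Π u : TangentBundle 𝓘(ℝ, E) M, PB E M u)
    {u : TangentBundle 𝓘(ℝ, E) M} (hu : u ∈ slit E M) :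
    hCurv D X Y Z u = -hCov D X (hCov D Y Z) u + hCov D Y (hCov D X Z) u
      + hCov D (hCov D X Y - hCov D Y X) Z u := by
  rw [hCurv, curvature, mlieBracket_hLift hD hint hX hY hu]
  rfl

/-- This is the Jacobi identity for the horizontal lifts, projected by `ρ`. The inner brackets must
be replaced by lifts on a neighbourhood of `u`, not only at `u`. -/
theorem hCov_jacobi (hD : IsCartanConnection L D) (hint : IsHorizontallyIntegrable D)
    {X Y Z : Π u : TangentBundle 𝓘(ℝ, E) M, PB E M u} (hX : IsPiVectorField X)
    (hY : IsPiVectorField Y) (hZ : IsPiVectorField Z)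
    {u : TangentBundle 𝓘(ℝ, E) M} (hu : u ∈ slit E M) :
    hCov D X (hCov D Y Z - hCov D Z Y) u - hCov D (hCov D Y Z - hCov D Z Y) X u =
      hCov D (hCov D X Y - hCov D Y X) Z u - hCov D Z (hCov D X Y - hCov D Y X) u +
        (hCov D Y (hCov D X Z - hCov D Z X) u - hCov D (hCov D X Z - hCov D Z X) Y u) := by
  have hbr : ∀ {X Y : Π u : TangentBundle 𝓘(ℝ, E) M, PB E M u}, IsPiVectorField X →
      IsPiVectorField Y → IsPiVectorField (hCov D X Y - hCov D Y X) := fun hX hY ↦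
    ContMDiffOn.sub_section (isPiVectorField_hCov hD.linear hD.regular hX hY)
      (isPiVectorField_hCov hD.linear hD.regular hY hX)
  have hev : ∀ {X Y : Π u : TangentBundle 𝓘(ℝ, E) M, PB E M u}, IsPiVectorField X →
      IsPiVectorField Y → VectorField.mlieBracket 𝓘(ℝ, E).tangent (hLift D X) (hLift D Y)
        =ᶠ[nhds u] hLift D (hCov D X Y - hCov D Y X) := fun hX hY ↦ by
    filter_upwards [isOpen_slit.mem_nhds hu] with w hw
    exact mlieBracket_hLift hD hint hX hY hw
  have hsm : ∀ {X : Π u : TangentBundle 𝓘(ℝ, E) M, PB E M u}, IsPiVectorField X →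
      ContMDiffAt 𝓘(ℝ, E).tangent 𝓘(ℝ, E).tangent.tangent (minSmoothness ℝ 2)
        (fun w ↦ (⟨w, hLift D X w⟩ :
          TangentBundle 𝓘(ℝ, E).tangent (TangentBundle 𝓘(ℝ, E) M))) u := fun hX ↦
    (ContMDiffOn.contMDiffAt (isVectorField_hLift hD.linear hD.regular hX)
      (isOpen_slit.mem_nhds hu)).of_le
        (by rw [minSmoothness_of_isRCLikeNormedField]; norm_cast)
  have : CompleteSpace (E × E) := FiniteDimensional.complete ℝ _
  have : IsManifold 𝓘(ℝ, E).tangent (minSmoothness ℝ 3) (TangentBundle 𝓘(ℝ, E) M) :=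
    IsManifold.of_le (n := ∞) (by rw [minSmoothness_of_isRCLikeNormedField]; norm_cast)
  have hjac := VectorField.leibniz_identity_mlieBracket_apply (hsm hX) (hsm hY) (hsm hZ)
  rw [(Filter.EventuallyEq.refl _ (hLift D X)).mlieBracket_vectorField_eq (hev hY hZ),
    (hev hX hY).mlieBracket_vectorField_eq (Filter.EventuallyEq.refl _ (hLift D Z)),
    (Filter.EventuallyEq.refl _ (hLift D Y)).mlieBracket_vectorField_eq (hev hX hZ),
    mlieBracket_hLift hD hint hX (hbr hY hZ) hu, mlieBracket_hLift hD hint (hbr hX hY) hZ hu,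
    mlieBracket_hLift hD hint hY (hbr hX hZ) hu] at hjac
  have := congrArg (rho u) hjac
  rw [map_add] at this
  simpa only [hLift, rho_beta hD.regular hu, Pi.sub_apply] using this

end Calculus


/-! ### The ring of functions and the module of fields on `𝒯M`, and the calculus on them -/

section Restriction

variable (E : Type*) [NormedAddCommGroup E] [NormedSpace ℝ E]
  (M : Type*) [TopologicalSpace M] [ChartedSpace E M] [IsManifold 𝓘(ℝ, E) ∞ M]

/-- The ring of smooth functions on `𝒯M`. -/
def smoothFn : Subring (slit E M → ℝ) where
  carrier := {f | ∃ F : TangentBundle 𝓘(ℝ, E) M → ℝ,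
    ContMDiffOn 𝓘(ℝ, E).tangent 𝓘(ℝ, ℝ) ∞ F (slit E M) ∧ ∀ u : slit E M, F u = f u}
  mul_mem' := by
    rintro f g ⟨F, hF, hFf⟩ ⟨G, hG, hGg⟩
    exact ⟨F * G, hF.mul hG, fun u ↦ by simp [hFf, hGg]⟩
  one_mem' := ⟨1, contMDiffOn_const, fun _ ↦ rfl⟩
  add_mem' := by
    rintro f g ⟨F, hF, hFf⟩ ⟨G, hG, hGg⟩
    exact ⟨F + G, hF.add hG, fun u ↦ by simp [hFf, hGg]⟩
  zero_mem' := ⟨0, contMDiffOn_const, fun _ ↦ rfl⟩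
  neg_mem' := by
    rintro f ⟨F, hF, hFf⟩
    exact ⟨-F, hF.neg, fun u ↦ by simp [hFf]⟩

/-- The module of `π`-vector fields on `𝒯M`. -/
def piFields : Submodule (smoothFn E M) (Π u : slit E M, PB E M u) where
  carrier := {X | ∃ Y : Π u : TangentBundle 𝓘(ℝ, E) M, PB E M u,
    IsPiVectorField Y ∧ ∀ u : slit E M, Y u = X u}
  add_mem' := by
    rintro X Y ⟨X', hX', hX⟩ ⟨Y', hY', hY⟩
    exact ⟨X' + Y', hX'.add hY', fun u ↦ by simp [hX, hY]⟩
  zero_mem' := ⟨0, isPiVectorField_zero, fun _ ↦ rfl⟩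
  smul_mem' := by
    rintro ⟨f, F, hF, hFf⟩ X ⟨X', hX', hX⟩
    exact ⟨F • X', hX'.smul hF, fun u ↦ by
      rw [Pi.smul_apply', hX, hFf]; rfl⟩

/-- A smooth function on `𝒯M`. -/
abbrev SmoothFn : Type _ := smoothFn E M

/-- A `π`-vector field on `𝒯M`. -/
abbrev PiField : Type _ := piFields E M

noncomputable instance : Module (SmoothFn E M) (PiField E M) := (piFields E M).module

noncomputable instance : SMul (SmoothFn E M) (PiField E M) := (piFields E M).module.toSMul

variable {E M}

/-- An extension to `TM` of a smooth function on `𝒯M`. -/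
noncomputable def SmoothFn.lift (f : SmoothFn E M) : TangentBundle 𝓘(ℝ, E) M → ℝ := f.2.choose

theorem SmoothFn.contMDiffOn_lift (f : SmoothFn E M) :
    ContMDiffOn 𝓘(ℝ, E).tangent 𝓘(ℝ, ℝ) ∞ f.lift (slit E M) := f.2.choose_spec.1

theorem SmoothFn.lift_apply (f : SmoothFn E M) {u : TangentBundle 𝓘(ℝ, E) M} (hu : u ∈ slit E M) :
    f.lift u = f.1 ⟨u, hu⟩ := f.2.choose_spec.2 ⟨u, hu⟩

/-- An extension to `TM` of a `π`-vector field on `𝒯M`. -/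
noncomputable def PiField.lift (X : PiField E M) : Π u : TangentBundle 𝓘(ℝ, E) M, PB E M u :=
  X.2.choose

theorem PiField.isPiVectorField_lift (X : PiField E M) : IsPiVectorField X.lift :=
  X.2.choose_spec.1

theorem PiField.lift_apply (X : PiField E M) {u : TangentBundle 𝓘(ℝ, E) M} (hu : u ∈ slit E M) :
    X.lift u = X.1 ⟨u, hu⟩ := X.2.choose_spec.2 ⟨u, hu⟩

/-- The restriction to `𝒯M` of a smooth function. -/
def SmoothFn.res (F : TangentBundle 𝓘(ℝ, E) M → ℝ)
    (hF : ContMDiffOn 𝓘(ℝ, E).tangent 𝓘(ℝ, ℝ) ∞ F (slit E M)) : SmoothFn E M :=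
  ⟨fun u ↦ F u, F, hF, fun _ ↦ rfl⟩

/-- The restriction to `𝒯M` of a `π`-vector field. -/
def IsPiVectorField.res {X : Π u : TangentBundle 𝓘(ℝ, E) M, PB E M u} (hX : IsPiVectorField X) :
    PiField E M :=
  ⟨fun u ↦ X u, X, hX, fun _ ↦ rfl⟩

theorem IsPiVectorField.lift_res {X : Π u : TangentBundle 𝓘(ℝ, E) M, PB E M u}
    (hX : IsPiVectorField X) {u : TangentBundle 𝓘(ℝ, E) M} (hu : u ∈ slit E M) :
    hX.res.lift u = X u :=
  hX.res.lift_apply hu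

theorem PiField.lift_add (X Y : PiField E M) {u : TangentBundle 𝓘(ℝ, E) M} (hu : u ∈ slit E M) :
    (X + Y).lift u = (X.lift + Y.lift) u := by
  rw [Pi.add_apply, lift_apply _ hu, lift_apply _ hu, lift_apply _ hu]; rfl

theorem PiField.lift_smul (f : SmoothFn E M) (X : PiField E M) {u : TangentBundle 𝓘(ℝ, E) M}
    (hu : u ∈ slit E M) : (f • X).lift u = (f.lift • X.lift) u := by
  rw [Pi.smul_apply', lift_apply _ hu, lift_apply _ hu, SmoothFn.lift_apply _ hu]; rfl

theorem mvfderiv_congr {f g : TangentBundle 𝓘(ℝ, E) M → ℝ} (h : ∀ u ∈ slit E M, f u = g u)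
    {u : TangentBundle 𝓘(ℝ, E) M} (hu : u ∈ slit E M) :
    mvfderiv 𝓘(ℝ, E).tangent f u = mvfderiv 𝓘(ℝ, E).tangent g u := by
  have hfg : f =ᶠ[nhds u] g := by
    filter_upwards [isOpen_slit.mem_nhds hu] with w hw using h w hw
  ext ξ
  unfold mvfderiv
  rw [hfg.mfderiv_eq]
  rfl

theorem mvfderiv_add_apply {f g : TangentBundle 𝓘(ℝ, E) M → ℝ}
    (hf : ContMDiffOn 𝓘(ℝ, E).tangent 𝓘(ℝ, ℝ) ∞ f (slit E M))
    (hg : ContMDiffOn 𝓘(ℝ, E).tangent 𝓘(ℝ, ℝ) ∞ g (slit E M))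
    {u : TangentBundle 𝓘(ℝ, E) M} (hu : u ∈ slit E M) (ξ : TangentSpace 𝓘(ℝ, E).tangent u) :
    mvfderiv 𝓘(ℝ, E).tangent (f + g) u ξ =
      mvfderiv 𝓘(ℝ, E).tangent f u ξ + mvfderiv 𝓘(ℝ, E).tangent g u ξ := by
  have hd : ∀ {f : TangentBundle 𝓘(ℝ, E) M → ℝ},
      ContMDiffOn 𝓘(ℝ, E).tangent 𝓘(ℝ, ℝ) ∞ f (slit E M) →
      MDifferentiableAt 𝓘(ℝ, E).tangent 𝓘(ℝ, ℝ) f u := fun hf ↦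
    (hf.contMDiffAt (isOpen_slit.mem_nhds hu)).mdifferentiableAt (by simp)
  unfold mvfderiv
  rw [((hd hf).hasMFDerivAt.add (hd hg).hasMFDerivAt).mfderiv]
  rfl

variable [FiniteDimensional ℝ E] {L : TangentBundle 𝓘(ℝ, E) M → ℝ} {D : Conn E M}

/-- The h-covariant derivative of an integrable Cartan connection as an operation on the module of
`π`-vector fields. -/
noncomputable def hCalculus (hL : IsFinslerStructure L) (hD : IsCartanConnection L D)
    (hint : IsHorizontallyIntegrable D) : CovCalculus (SmoothFn E M) (PiField E M) where
  nabla := AddMonoidHom.mk' (fun X ↦ AddMonoidHom.mk'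
      (fun Y ↦ (isPiVectorField_hCov hD.linear hD.regular X.isPiVectorField_lift
        Y.isPiVectorField_lift).res)
      (fun Y Y' ↦ Subtype.ext <| funext fun u ↦
        (hCov_congr hD.linear (Y.isPiVectorField_lift.add Y'.isPiVectorField_lift) u.2 rfl
          (fun _ hw ↦ PiField.lift_add Y Y' hw)).trans
          (hCov_add_right hD.linear _ Y.isPiVectorField_lift Y'.isPiVectorField_lift u.2)))
    (fun X X' ↦ by
      ext1 Y
      exact Subtype.ext <| funext fun u ↦
        (hCov_congr hD.linear Y.isPiVectorField_lift u.2 (PiField.lift_add X X' u.2)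
          (fun _ _ ↦ rfl)).trans (hCov_add_left D _ _ _ _))
  der X := AddMonoidHom.mk' (fun f ↦ SmoothFn.res _ (contMDiffOn_mvfderiv_beta hL hD.linear
      hD.regular X.isPiVectorField_lift f.contMDiffOn_lift))
    (fun f g ↦ Subtype.ext <| funext fun u ↦ by
      refine (congrArg (fun φ ↦ φ (beta D u.1 (X.lift u.1))) (mvfderiv_congr (g := f.lift + g.lift)
        (fun w hw ↦ ?_) u.2)).trans
        (mvfderiv_add_apply f.contMDiffOn_lift g.contMDiffOn_lift u.2 _)
      rw [Pi.add_apply, SmoothFn.lift_apply _ hw, SmoothFn.lift_apply _ hw,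
        SmoothFn.lift_apply _ hw]
      rfl)
  nabla_smul_left f X Y := Subtype.ext <| funext fun u ↦ by
    refine ((hCov_congr hD.linear Y.isPiVectorField_lift u.2 (PiField.lift_smul f X u.2)
          (fun _ _ ↦ rfl)).trans (hCov_smul_left D _ _ _ _)).trans ?_
    rw [f.lift_apply u.2]; rfl
  nabla_smul f X Y := Subtype.ext <| funext fun u ↦ by
    refine ((hCov_congr hD.linear (Y.isPiVectorField_lift.smul f.contMDiffOn_lift) u.2 rfl
          (fun _ hw ↦ PiField.lift_smul f Y hw)).trans
          (hCov_smul_right hD.linear _ f.contMDiffOn_lift Y.isPiVectorField_lift u.2)).trans ?_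
    rw [f.lift_apply u.2, Y.lift_apply u.2]; rfl
  jacobi X Y Z := by
    have hsub : ∀ (X Y : PiField E M),
        ∀ w ∈ slit E M, ((isPiVectorField_hCov hD.linear hD.regular X.isPiVectorField_lift
          Y.isPiVectorField_lift).res - (isPiVectorField_hCov hD.linear hD.regular
          Y.isPiVectorField_lift X.isPiVectorField_lift).res).lift w =
          (hCov D X.lift Y.lift - hCov D Y.lift X.lift) w := fun X Y w hw ↦ by
      rw [PiField.lift_apply _ hw]; rfl
    have hpi : ∀ (X Y : PiField E M), IsPiVectorField
        (hCov D X.lift Y.lift - hCov D Y.lift X.lift) := fun X Y ↦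
      ContMDiffOn.sub_section (isPiVectorField_hCov hD.linear hD.regular X.isPiVectorField_lift
        Y.isPiVectorField_lift) (isPiVectorField_hCov hD.linear hD.regular Y.isPiVectorField_lift
        X.isPiVectorField_lift)
    have hr : ∀ (X Y Z : PiField E M) (u : slit E M), hCov D Z.lift
        ((isPiVectorField_hCov hD.linear hD.regular X.isPiVectorField_lift
          Y.isPiVectorField_lift).res - (isPiVectorField_hCov hD.linear hD.regular
          Y.isPiVectorField_lift X.isPiVectorField_lift).res).lift u.1 =
        hCov D Z.lift (hCov D X.lift Y.lift - hCov D Y.lift X.lift) u.1 := fun X Y Z u ↦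
      hCov_congr hD.linear (hpi X Y) u.2 rfl (hsub X Y)
    have hl : ∀ (X Y Z : PiField E M) (u : slit E M), hCov D
        ((isPiVectorField_hCov hD.linear hD.regular X.isPiVectorField_lift
          Y.isPiVectorField_lift).res - (isPiVectorField_hCov hD.linear hD.regular
          Y.isPiVectorField_lift X.isPiVectorField_lift).res).lift Z.lift u.1 =
        hCov D (hCov D X.lift Y.lift - hCov D Y.lift X.lift) Z.lift u.1 := fun X Y Z u ↦
      hCov_congr hD.linear Z.isPiVectorField_lift u.2 (hsub X Y _ u.2) (fun _ _ ↦ rfl)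
    refine Subtype.ext <| funext fun u ↦ ?_
    have h := hCov_jacobi hD hint X.isPiVectorField_lift Y.isPiVectorField_lift
      Z.isPiVectorField_lift u.2
    rw [← hr, ← hl, ← hr, ← hl, ← hr, ← hl] at h
    exact h

end Restriction


/-! ### Skew endomorphisms acting on tensors -/

section LinearAlgebra

theorem exists_orthonormal_basis {V : Type*} [AddCommGroup V] [Module ℝ V] [FiniteDimensional ℝ V]
    (B : LinearMap.BilinForm ℝ V) (hsymm : ∀ v w, B v w = B w v) (hpos : ∀ v, v ≠ 0 → 0 < B v v) :
    ∃ b : Module.Basis (Fin (Module.finrank ℝ V)) ℝ V,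
      ∀ i j, B (b i) (b j) = if i = j then 1 else 0 := by
  obtain ⟨v, hv⟩ := LinearMap.BilinForm.exists_orthogonal_basis
    (B := B) (by exact ⟨fun v w ↦ hsymm v w⟩)
  have hq : ∀ i, 0 < B (v i) (v i) := fun i ↦ hpos _ (v.ne_zero i)
  have hs : ∀ i, IsUnit ((Real.sqrt (B (v i) (v i)))⁻¹) := fun i ↦
    (inv_ne_zero (Real.sqrt_pos.2 (hq i)).ne').isUnit
  refine ⟨v.isUnitSMul hs, fun i j ↦ ?_⟩
  simp only [Module.Basis.isUnitSMul_apply, map_smul, LinearMap.smul_apply, smul_eq_mul]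
  split_ifs with h
  · subst h
    have h1 := Real.mul_self_sqrt (hq i).le
    have h2 := (Real.sqrt_pos.2 (hq i)).ne'
    field_simp
    rw [sq, h1]
  · have : B (v i) (v j) = 0 := hv h
    rw [this, mul_zero, mul_zero]

/-- Exchanging the two summation indices turns the sum into its own negative. -/
theorem sum_skew_eq_zero {ι : Type*} [Fintype ι] {t : ι → ι → ℝ} (ht : ∀ i j, t i j = -t j i)
    (x : ι → ℝ) : ∑ i, (∑ m, t i m * x m) * x i = 0 := by
  have h : ∑ i, (∑ m, t i m * x m) * x i = -∑ i, (∑ m, t i m * x m) * x i := by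
    simp only [Finset.sum_mul]
    conv_rhs => rw [Finset.sum_comm]
    rw [← Finset.sum_neg_distrib]
    refine Finset.sum_congr rfl fun i _ ↦ ?_
    rw [← Finset.sum_neg_distrib]
    refine Finset.sum_congr rfl fun m _ ↦ ?_
    rw [ht i m]; ring
  linarith

/-- A nonzero tensor is not an eigenvector, for a nonzero eigenvalue, of a skew-symmetric
endomorphism acting as a derivation. -/
theorem eigenvalue_eq_zero_of_skew {ι : Type*} [Fintype ι] {t : ι → ι → ℝ}
    (ht : ∀ i j, t i j = -t j i) {r : ι → ι → ι → ι → ℝ} {c : ℝ}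
    (hr : ∀ i j k l, c * r i j k l = ∑ m, t i m * r m j k l + ∑ m, t j m * r i m k l
      + ∑ m, t k m * r i j m l + ∑ m, t l m * r i j k m) :
    c = 0 ∨ ∀ i j k l, r i j k l = 0 := by
  have rot3 : ∀ f : ι → ι → ι → ℝ, ∑ j, ∑ k, ∑ l, f j k l = ∑ k, ∑ l, ∑ j, f j k l := fun f ↦ by
    rw [Finset.sum_comm]
    exact Finset.sum_congr rfl fun k _ ↦ Finset.sum_comm
  have rot4 : ∀ f : ι → ι → ι → ι → ℝ, ∑ i, ∑ j, ∑ k, ∑ l, f i j k l =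
      ∑ j, ∑ k, ∑ l, ∑ i, f i j k l := fun f ↦ by
    rw [Finset.sum_comm]
    exact Finset.sum_congr rfl fun j _ ↦ rot3 _
  have e1 : ∑ i, ∑ j, ∑ k, ∑ l, (∑ m, t i m * r m j k l) * r i j k l = 0 := by
    rw [rot4]
    exact Finset.sum_eq_zero fun j _ ↦ Finset.sum_eq_zero fun k _ ↦ Finset.sum_eq_zero fun l _ ↦
      sum_skew_eq_zero ht fun i ↦ r i j k l
  have e2 : ∑ i, ∑ j, ∑ k, ∑ l, (∑ m, t j m * r i m k l) * r i j k l = 0 := by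
    refine Finset.sum_eq_zero fun i _ ↦ ?_
    rw [rot3]
    exact Finset.sum_eq_zero fun k _ ↦ Finset.sum_eq_zero fun l _ ↦
      sum_skew_eq_zero ht fun j ↦ r i j k l
  have e3 : ∑ i, ∑ j, ∑ k, ∑ l, (∑ m, t k m * r i j m l) * r i j k l = 0 := by
    refine Finset.sum_eq_zero fun i _ ↦ Finset.sum_eq_zero fun j _ ↦ ?_
    rw [Finset.sum_comm]
    exact Finset.sum_eq_zero fun l _ ↦ sum_skew_eq_zero ht fun k ↦ r i j k l
  have e4 : ∑ i, ∑ j, ∑ k, ∑ l, (∑ m, t l m * r i j k m) * r i j k l = 0 :=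
    Finset.sum_eq_zero fun i _ ↦ Finset.sum_eq_zero fun j _ ↦ Finset.sum_eq_zero fun k _ ↦
      sum_skew_eq_zero ht fun l ↦ r i j k l
  -- Contracting the eigenvalue equation with `r` kills all four terms on the right, leaving `c`
  -- times the squared norm of `r`.
  have hsum : c * ∑ i, ∑ j, ∑ k, ∑ l, r i j k l * r i j k l = 0 := by
    have h : ∀ i j k l, c * (r i j k l * r i j k l) =
        (∑ m, t i m * r m j k l) * r i j k l + (∑ m, t j m * r i m k l) * r i j k l
        + (∑ m, t k m * r i j m l) * r i j k l + (∑ m, t l m * r i j k m) * r i j k l := by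
      intro i j k l
      rw [← mul_assoc, hr]; ring
    simp only [Finset.mul_sum, h, Finset.sum_add_distrib, e1, e2, e3, e4, add_zero]
  refine (mul_eq_zero.1 hsum).imp_right fun h0 i j k l ↦ ?_
  have hnn : ∀ i j k l, 0 ≤ r i j k l * r i j k l := fun i j k l ↦ mul_self_nonneg _
  have h1 := (Finset.sum_eq_zero_iff_of_nonneg fun i _ ↦ Finset.sum_nonneg fun j _ ↦
    Finset.sum_nonneg fun k _ ↦ Finset.sum_nonneg fun l _ ↦ hnn i j k l).1 h0 i (Finset.mem_univ _)
  have h2 := (Finset.sum_eq_zero_iff_of_nonneg fun j _ ↦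
    Finset.sum_nonneg fun k _ ↦ Finset.sum_nonneg fun l _ ↦ hnn i j k l).1 h1 j (Finset.mem_univ _)
  have h3 := (Finset.sum_eq_zero_iff_of_nonneg fun k _ ↦
    Finset.sum_nonneg fun l _ ↦ hnn i j k l).1 h2 k (Finset.mem_univ _)
  have h4 := (Finset.sum_eq_zero_iff_of_nonneg fun l _ ↦ hnn i j k l).1 h3 l (Finset.mem_univ _)
  exact mul_self_eq_zero.1 h4

end LinearAlgebra

/-! ### Pointwise dependence of function-linear maps -/

section Tensoriality

variable {E : Type*} [NormedAddCommGroup E] [NormedSpace ℝ E]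
  {M : Type*} [TopologicalSpace M] [ChartedSpace E M] [IsManifold 𝓘(ℝ, E) ∞ M]

/-- The value of a `π`-vector field at a point. -/
def PiField.eval (u : slit E M) : PiField E M →+ PB E M u where
  toFun X := X.1 u
  map_zero' := rfl
  map_add' _ _ := rfl

theorem PiField.eval_smul (u : slit E M) (f : SmoothFn E M) (X : PiField E M) :
    PiField.eval u (f • X) = f.1 u • PiField.eval u X := rfl

variable [FiniteDimensional ℝ E] [T2Space M]

theorem PiField.exists_eval_eq (u : slit E M) (v : PB E M u) :
    ∃ X : PiField E M, PiField.eval u X = v := by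
  obtain ⟨X, hX, hXv⟩ := exists_isPiVectorField_eq u.1 v
  exact ⟨hX.res, hXv⟩

/-- Expand `ψ X` in a cut-off frame with `ψ = 1` at `u`: the coefficients vanish at `u`, and
linearity over functions carries this to `Φ X`. -/
theorem eval_map_eq_zero (Φ : PiField E M →ₗ[SmoothFn E M] PiField E M) {u : slit E M}
    {X : PiField E M} (hX : PiField.eval u X = 0) : PiField.eval u (Φ X) = 0 := by
  obtain ⟨s, b, ψ, hs, hsb, hψu, hψ, hfr⟩ := exists_frame u.1
  obtain ⟨c, hc, hcX⟩ := hfr X.lift X.isPiVectorField_lift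
  have h1 : SmoothFn.res ψ hψ • X = ∑ i, SmoothFn.res (c i) (hc i) • (hs i).res := by
    refine Subtype.ext <| funext fun w ↦ ?_
    have h := hcX w.1
    rw [X.lift_apply w.2] at h
    refine h.trans ?_
    change _ = PiField.eval w (∑ i, SmoothFn.res (c i) (hc i) • (hs i).res)
    rw [map_sum]
    rfl
  have h2 := congrArg (PiField.eval u) h1
  rw [PiField.eval_smul, hX, smul_zero, map_sum] at h2
  have h3 : ∑ i, c i u • b i = 0 := by
    rw [h2]
    refine Finset.sum_congr rfl fun i _ ↦ ?_
    rw [← hsb i]; rfl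
  have h4 : ∀ i, c i u = 0 := Fintype.linearIndependent_iff.1 b.linearIndependent _ h3
  have h5 := congrArg (fun Z ↦ PiField.eval u (Φ Z)) h1
  simp only [map_smul, map_sum, PiField.eval_smul] at h5
  have h6 : (SmoothFn.res ψ hψ).1 u = 1 := hψu
  rw [h6, one_smul] at h5
  rw [h5]
  refine Finset.sum_eq_zero fun i _ ↦ ?_
  have h7 : (SmoothFn.res (c i) (hc i)).1 u = 0 := h4 i
  rw [h7, zero_smul]

theorem eval_map_sum (Φ : PiField E M →ₗ[SmoothFn E M] PiField E M) {u : slit E M}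
    {ι : Type*} [Fintype ι] {X : PiField E M} {c : ι → ℝ} {Y : ι → PiField E M}
    (hX : PiField.eval u X = ∑ i, c i • PiField.eval u (Y i)) :
    PiField.eval u (Φ X) = ∑ i, c i • PiField.eval u (Φ (Y i)) := by
  let C : ι → SmoothFn E M := fun i ↦ SmoothFn.res (fun _ ↦ c i) contMDiffOn_const
  have h : PiField.eval u (X - ∑ i, C i • Y i) = 0 := by
    rw [map_sub, map_sum, hX, sub_eq_zero]
    rfl
  have h2 := eval_map_eq_zero Φ h
  rw [map_sub, map_sub, sub_eq_zero, map_sum, map_sum] at h2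
  rw [h2]
  refine Finset.sum_congr rfl fun i _ ↦ ?_
  rw [map_smul, PiField.eval_smul]
  rfl

end Tensoriality


/-! ### Vanishing of `B`, and the alternative `d̄A = 0` or `R = 0` -/

section Main

variable {E : Type*} [NormedAddCommGroup E] [NormedSpace ℝ E]
  {M : Type*} [TopologicalSpace M] [ChartedSpace E M] [IsManifold 𝓘(ℝ, E) ∞ M]
  {L : TangentBundle 𝓘(ℝ, E) M → ℝ} {D : Conn E M}

/-- The Finsler metric as a biadditive map on `π`-vector fields. -/
noncomputable def metricHom (hL : IsFinslerStructure L) :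
    PiField E M →+ PiField E M →+ SmoothFn E M :=
  AddMonoidHom.mk' (fun X ↦ AddMonoidHom.mk'
      (fun Y ↦ SmoothFn.res _ (contMDiffOn_metric hL X.isPiVectorField_lift Y.isPiVectorField_lift))
      (fun Y Y' ↦ Subtype.ext <| funext fun u ↦ by
        obtain ⟨B, hB, -⟩ := exists_bilinForm_metric hL u.2
        change metric L u.1 (X.lift u.1) ((Y + Y').lift u.1) =
          metric L u.1 (X.lift u.1) (Y.lift u.1) + metric L u.1 (X.lift u.1) (Y'.lift u.1)
        rw [PiField.lift_add Y Y' u.2, Pi.add_apply, ← hB, ← hB, ← hB, map_add]))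
    (fun X X' ↦ by
      ext1 Y
      refine Subtype.ext <| funext fun u ↦ ?_
      obtain ⟨B, hB, -⟩ := exists_bilinForm_metric hL u.2
      change metric L u.1 ((X + X').lift u.1) (Y.lift u.1) =
          metric L u.1 (X.lift u.1) (Y.lift u.1) + metric L u.1 (X'.lift u.1) (Y.lift u.1)
      rw [PiField.lift_add X X' u.2, Pi.add_apply, ← hB, ← hB, ← hB, map_add, LinearMap.add_apply])

theorem metricHom_apply (hL : IsFinslerStructure L) (X Y : PiField E M) (u : slit E M) :
    (metricHom hL X Y).1 u = metric L u.1 (PiField.eval u X) (PiField.eval u Y) := by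
  change metric L u.1 (X.lift u.1) (Y.lift u.1) = _
  rw [X.lift_apply u.2, Y.lift_apply u.2]
  rfl

theorem SmoothFn.mvfderiv_lift (f : SmoothFn E M) {F : TangentBundle 𝓘(ℝ, E) M → ℝ}
    (h : ∀ u : slit E M, F u = f.1 u) {u : TangentBundle 𝓘(ℝ, E) M} (hu : u ∈ slit E M) :
    mvfderiv 𝓘(ℝ, E).tangent f.lift u = mvfderiv 𝓘(ℝ, E).tangent F u :=
  mvfderiv_congr (fun w hw ↦ by rw [f.lift_apply hw, h ⟨w, hw⟩]) hu

/-- `η` vanishes nowhere on `𝒯M`. This supplies the faithful parallel field required by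
`der_bracket` and `curv_skew`. -/
theorem eq_zero_of_smul_etaField (f : SmoothFn E M)
    (hf : f • (IsPiVectorField.res isPiVectorField_eta : PiField E M) = 0) : f = 0 := by
  refine Subtype.ext <| funext fun u ↦ ?_
  have h := congrArg (PiField.eval u) hf
  rw [PiField.eval_smul, map_zero, smul_eq_zero] at h
  exact h.resolve_right u.2

theorem PiField.res_lift (X : PiField E M) : X.isPiVectorField_lift.res = X :=
  Subtype.ext <| funext fun u ↦ X.lift_apply u.2

/-- A scalar `π`-form as a map from `π`-vector fields to functions. -/
noncomputable def IsScalarForm.toFun {A : Π u : TangentBundle 𝓘(ℝ, E) M, PB E M u →L[ℝ] ℝ}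
    (hA : IsScalarForm A) (X : PiField E M) : SmoothFn E M :=
  SmoothFn.res _ (hA.smooth X.lift X.isPiVectorField_lift)

theorem IsScalarForm.toFun_apply {A : Π u : TangentBundle 𝓘(ℝ, E) M, PB E M u →L[ℝ] ℝ}
    (hA : IsScalarForm A) (X : PiField E M) (u : slit E M) :
    (hA.toFun X).1 u = A u (PiField.eval u X) :=
  congrArg (A u.1) (X.lift_apply u.2)

variable [FiniteDimensional ℝ E] (hL : IsFinslerStructure L) (hD : IsCartanConnection L D)
    (hint : IsHorizontallyIntegrable D)

theorem hCalculus_der_metricHom (X Y Z : PiField E M) :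
    (hCalculus hL hD hint).der X (metricHom hL Y Z) =
      metricHom hL ((hCalculus hL hD hint).nabla X Y) Z
        + metricHom hL Y ((hCalculus hL hD hint).nabla X Z) := by
  refine Subtype.ext <| funext fun u ↦ ?_
  have h := hD.isMetric Y.lift Z.lift Y.isPiVectorField_lift Z.isPiVectorField_lift u.1 u.2
    (beta D u.1 (X.lift u.1))
  rw [← SmoothFn.mvfderiv_lift (metricHom hL Y Z) (fun _ ↦ rfl) u.2] at h
  refine h.trans ?_
  change _ = (metricHom hL ((hCalculus hL hD hint).nabla X Y) Z).1 u
    + (metricHom hL Y ((hCalculus hL hD hint).nabla X Z)).1 u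
  rw [metricHom_apply, metricHom_apply, Y.lift_apply u.2, Z.lift_apply u.2]
  rfl

theorem nabla_res {X Y : Π u : TangentBundle 𝓘(ℝ, E) M, PB E M u} (hX : IsPiVectorField X)
    (hY : IsPiVectorField Y) :
    (hCalculus hL hD hint).nabla hX.res hY.res =
      (isPiVectorField_hCov hD.linear hD.regular hX hY).res :=
  Subtype.ext <| funext fun u ↦ hCov_congr hD.linear hY u.2 (hX.lift_res u.2)
    (fun _ hw ↦ hY.lift_res hw)

theorem nabla_etaField (X : PiField E M) :
    (hCalculus hL hD hint).nabla X isPiVectorField_eta.res = 0 := by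
  refine Subtype.ext <| funext fun u ↦ ?_
  exact (hCov_congr (X := X.lift) hD.linear isPiVectorField_eta u.2 rfl
    (fun _ hw ↦ isPiVectorField_eta.lift_res hw)).trans (hCov_eta hD.regular _ u.2)

theorem isPiVectorField_hCurv (hD : IsCartanConnection L D) (hint : IsHorizontallyIntegrable D)
    {X Y Z : Π u : TangentBundle 𝓘(ℝ, E) M, PB E M u}
    (hX : IsPiVectorField X) (hY : IsPiVectorField Y) (hZ : IsPiVectorField Z) :
    IsPiVectorField (hCurv D X Y Z) := by
  have h : ∀ {X Y : Π u : TangentBundle 𝓘(ℝ, E) M, PB E M u}, IsPiVectorField X →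
      IsPiVectorField Y → IsPiVectorField (hCov D X Y) := fun hX hY ↦
    isPiVectorField_hCov hD.linear hD.regular hX hY
  have hs : IsPiVectorField (hCov D X Y - hCov D Y X) := (h hX hY).sub (h hY hX)
  have hn : IsPiVectorField (-hCov D X (hCov D Y Z)) := (h hX (h hY hZ)).neg
  exact ((hn.add (h hY (h hX hZ))).add (h hs hZ)).congr fun u hu ↦ hCurv_apply hD hint hX hY Z hu

theorem curv_res {X Y Z : Π u : TangentBundle 𝓘(ℝ, E) M, PB E M u}
    (hX : IsPiVectorField X) (hY : IsPiVectorField Y) (hZ : IsPiVectorField Z) :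
    (hCalculus hL hD hint).curv hX.res hY.res hZ.res =
      (isPiVectorField_hCurv hD hint hX hY hZ).res := by
  have hs : (isPiVectorField_hCov hD.linear hD.regular hX hY).res
      - (isPiVectorField_hCov hD.linear hD.regular hY hX).res =
      ((isPiVectorField_hCov hD.linear hD.regular hX hY).sub
        (isPiVectorField_hCov hD.linear hD.regular hY hX)).res := rfl
  rw [CovCalculus.curv, nabla_res, nabla_res, nabla_res, nabla_res, nabla_res, nabla_res, hs,
    nabla_res]
  exact Subtype.ext <| funext fun u ↦ (hCurv_apply hD hint hX hY Z u.2).symm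

theorem eval_nablaCurv_res {X Y Z W : Π u : TangentBundle 𝓘(ℝ, E) M, PB E M u}
    (hX : IsPiVectorField X) (hY : IsPiVectorField Y) (hZ : IsPiVectorField Z)
    (hW : IsPiVectorField W) (u : slit E M) :
    PiField.eval u ((hCalculus hL hD hint).nablaCurv hX.res hY.res hZ.res hW.res) =
      hCovCurv D X Y Z W u := by
  rw [CovCalculus.nablaCurv, curv_res, nabla_res, nabla_res, nabla_res, nabla_res, curv_res,
    curv_res, curv_res]
  rfl

theorem extDer_res {A : Π u : TangentBundle 𝓘(ℝ, E) M, PB E M u →L[ℝ] ℝ} (hA : IsScalarForm A)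
    {X Y : Π u : TangentBundle 𝓘(ℝ, E) M, PB E M u} (hX : IsPiVectorField X)
    (hY : IsPiVectorField Y) (u : slit E M) :
    ((hCalculus hL hD hint).extDer hA.toFun hX.res hY.res).1 u = dBar D A X Y u := by
  have h : ∀ {X Y : Π u : TangentBundle 𝓘(ℝ, E) M, PB E M u} (hX : IsPiVectorField X)
      (hY : IsPiVectorField Y),
      ((hCalculus hL hD hint).der hX.res (hA.toFun hY.res)).1 u
        - (hA.toFun ((hCalculus hL hD hint).nabla hX.res hY.res)).1 u = hCovForm D A X Y u := by
    intro X Y hX hY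
    rw [nabla_res, hA.toFun_apply, hCovForm]
    congr 1
    change mvfderiv 𝓘(ℝ, E).tangent (hA.toFun hY.res).lift u.1 (beta D u.1 (hX.res.lift u.1)) = _
    rw [hX.lift_res u.2, SmoothFn.mvfderiv_lift (F := fun w ↦ A w (Y w)) _
      (fun w ↦ (hA.toFun_apply hY.res w).symm) u.2]
  rw [dBar, ← h hX hY, ← h hY hX]
  rfl

/-- The recurrence equation forces the recurrence form `B` to vanish when the horizontal
distribution is integrable. -/
theorem formB_eq_zero [T2Space M] (hL : IsFinslerStructure L) (hD : IsCartanConnection L D)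
    (hint : IsHorizontallyIntegrable D) (hn : 2 ≤ Module.finrank ℝ E)
    {A B : Π u : TangentBundle 𝓘(ℝ, E) M, PB E M u →L[ℝ] ℝ}
    (hrec : RecurrenceEquation L D A B) {u : TangentBundle 𝓘(ℝ, E) M} (hu : u ∈ slit E M) :
    B u = 0 := by
  refine ContinuousLinearMap.ext fun x ↦ ?_
  obtain ⟨X, hX, hXx⟩ := exists_isPiVectorField_eq u x
  -- The line spanned by `η` is a proper subspace as soon as the dimension is at least two.
  obtain ⟨v, hv⟩ : ∃ v : PB E M u, v ∉ Submodule.span ℝ {eta u} := by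
    by_contra! h
    have h1 : Submodule.span ℝ {(eta u : PB E M u)} = ⊤ := Submodule.eq_top_iff'.2 h
    have h2 : Module.finrank ℝ (Submodule.span ℝ {(eta u : PB E M u)}) = 1 :=
      finrank_span_singleton hu
    rw [h1, finrank_top] at h2
    exact absurd (hn.trans_eq h2) (by norm_num)
  obtain ⟨Z, hZ, hZv⟩ := exists_isPiVectorField_eq u v
  have hη : IsPiVectorField (eta : Π u : TangentBundle 𝓘(ℝ, E) M, PB E M u) :=
    isPiVectorField_eta
  have hpar := nabla_etaField hL hD hint
  -- Each of the four terms contains `R(·, ·)η` or `∇_{βX} η`, and both are zero.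
  have h1 : hCovCurv D X eta Z eta u = 0 := by
    rw [← eval_nablaCurv_res hL hD hint hX hη hZ hη ⟨u, hu⟩, CovCalculus.nablaCurv,
      CovCalculus.curv_of_parallel _ hpar, CovCalculus.curv_of_parallel _ hpar,
      CovCalculus.curv_of_parallel _ hpar, hpar, map_zero]
    simp [CovCalculus.curv]
  have h2 : hCurv D eta Z eta u = 0 := by
    have h := congrArg (PiField.eval ⟨u, hu⟩) (curv_res hL hD hint hη hZ hη)
    rw [CovCalculus.curv_of_parallel _ hpar, map_zero] at h
    exact h.symm
  have h3 := hrec X eta Z eta hX hη hZ hη u hu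
  rw [h1, recTensor, h2, smul_zero, zero_add, tensorG, hZv, hXx, eq_comm, smul_eq_zero] at h3
  -- If `G(η, Z)η = g(η, η) Z - g(Z, η) η` vanished at `u`, then `v` would be the multiple of `η`
  -- with coefficient `g(v, η) / g(η, η)`.
  refine h3.resolve_right fun h4 ↦ hv ?_
  have h5 := (metric_eta_pos hL hu).ne'
  rw [sub_eq_zero] at h4
  rw [Submodule.mem_span_singleton]
  refine ⟨(metric L u (eta u) (eta u))⁻¹ * metric L u v (eta u), ?_⟩
  rw [mul_smul, ← h4, smul_smul, inv_mul_cancel₀ h5, one_smul]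

/-- With `B = 0` the recurrence equation reads `∇R = A ⊗ R`. -/
theorem nablaCurv_eq [T2Space M] (hn : 2 ≤ Module.finrank ℝ E)
    {A B : Π u : TangentBundle 𝓘(ℝ, E) M, PB E M u →L[ℝ] ℝ} (hA : IsScalarForm A)
    (hrec : RecurrenceEquation L D A B) (X Y Z W : PiField E M) :
    (hCalculus hL hD hint).nablaCurv X Y Z W =
      hA.toFun X • (hCalculus hL hD hint).curv Y Z W := by
  refine Subtype.ext <| funext fun u ↦ ?_
  have h := eval_nablaCurv_res hL hD hint X.isPiVectorField_lift Y.isPiVectorField_lift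
    Z.isPiVectorField_lift W.isPiVectorField_lift u
  have h' := congrArg (PiField.eval u) (curv_res hL hD hint Y.isPiVectorField_lift
    Z.isPiVectorField_lift W.isPiVectorField_lift)
  rw [hrec _ _ _ _ X.isPiVectorField_lift Y.isPiVectorField_lift
    Z.isPiVectorField_lift W.isPiVectorField_lift u.1 u.2, recTensor,
    formB_eq_zero hL hD hint hn hrec u.2, zero_apply, zero_smul, add_zero] at h
  simp only [PiField.res_lift] at h h'
  refine h.trans ?_
  change _ = (hA.toFun X).1 u • PiField.eval u ((hCalculus hL hD hint).curv Y Z W)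
  rw [h', hA.toFun_apply, X.lift_apply u.2]
  rfl

/-- For a recurrent curvature, at each point the exterior derivative of the recurrence form
vanishes or the curvature vanishes. -/
theorem extDer_eq_zero_or_curv_eq_zero [T2Space M] (A : PiField E M → SmoothFn E M)
    (hA : ∀ X Y Z W, (hCalculus hL hD hint).nablaCurv X Y Z W =
      A X • (hCalculus hL hD hint).curv Y Z W) (u : slit E M) (X Y : PiField E M) :
    ((hCalculus hL hD hint).extDer A X Y).1 u = 0 ∨
      ∀ U V W, PiField.eval u ((hCalculus hL hD hint).curv U V W) = 0 := by
  let N := hCalculus hL hD hint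
  obtain ⟨B, hB, hsymm⟩ := exists_bilinForm_metric hL u.2
  have : FiniteDimensional ℝ (PB E M u.1) := inferInstanceAs (FiniteDimensional ℝ E)
  -- In a `g`-orthonormal basis the skew operator `R(X, Y)` has a skew matrix. The basis vectors are
  -- extended to fields so that the module identities apply.
  obtain ⟨b, hb⟩ := exists_orthonormal_basis B hsymm fun v hv ↦ by
    rw [hB]; exact hL.posDef u.1 u.2 v hv
  choose e he using fun i ↦ PiField.exists_eval_eq u (b i)
  have hexp : ∀ Z : PiField E M, PiField.eval u Z =
      ∑ m, B (PiField.eval u Z) (b m) • PiField.eval u (e m) := fun Z ↦ by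
    simp only [he]
    have h := b.sum_repr (PiField.eval u Z)
    have hc : ∀ m, B (PiField.eval u Z) (b m) = b.repr (PiField.eval u Z) m := fun m ↦ by
      conv_lhs => rw [← h, map_sum, LinearMap.sum_apply]
      simp only [map_smul, LinearMap.smul_apply, hb, smul_eq_mul, mul_ite, mul_one, mul_zero,
        Finset.sum_ite_eq', Finset.mem_univ, if_true]
    simp only [hc, h]
  let c1 (y z : PiField E M) : PiField E M →ₗ[SmoothFn E M] PiField E M :=
    { toFun := fun x ↦ N.curv x y z
      map_add' := fun x x' ↦ N.curv_add_left x x' y z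
      map_smul' := fun f x ↦ N.curv_smul_left f x y z }
  let c2 (x z : PiField E M) : PiField E M →ₗ[SmoothFn E M] PiField E M :=
    { toFun := fun y ↦ N.curv x y z
      map_add' := fun y y' ↦ N.curv_add_middle x y y' z
      map_smul' := fun f y ↦ N.curv_smul_middle f x y z }
  let c3 (x y : PiField E M) : PiField E M →ₗ[SmoothFn E M] PiField E M :=
    { toFun := fun z ↦ N.curv x y z
      map_add' := fun z z' ↦ N.curv_add_right x y z z'
      map_smul' := fun f z ↦ N.curv_smul_right f x y z }
  have h1 : ∀ x y z, PiField.eval u (N.curv x y z) =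
      ∑ m, B (PiField.eval u x) (b m) • PiField.eval u (N.curv (e m) y z) := fun x y z ↦
    eval_map_sum (c1 y z) (hexp x)
  have h2 : ∀ x y z, PiField.eval u (N.curv x y z) =
      ∑ m, B (PiField.eval u y) (b m) • PiField.eval u (N.curv x (e m) z) := fun x y z ↦
    eval_map_sum (c2 x z) (hexp y)
  have h3 : ∀ x y z, PiField.eval u (N.curv x y z) =
      ∑ m, B (PiField.eval u z) (b m) • PiField.eval u (N.curv x y (e m)) := fun x y z ↦
    eval_map_sum (c3 x y) (hexp z)
  have hskew : ∀ Z W, B (PiField.eval u (N.curv X Y Z)) (PiField.eval u W) =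
      -B (PiField.eval u Z) (PiField.eval u (N.curv X Y W)) := fun Z W ↦ by
    have h := congrArg (fun f ↦ f.1 u) (N.curv_skew (nabla_etaField hL hD hint)
      eq_zero_of_smul_etaField (metricHom hL) (hCalculus_der_metricHom hL hD hint) X Y Z W)
    have h' : (-(metricHom hL) Z (N.curv X Y W)).1 u = -((metricHom hL) Z (N.curv X Y W)).1 u := rfl
    simp only [h', metricHom_apply] at h
    rw [hB, hB]
    exact h
  let t : Fin (Module.finrank ℝ (PB E M u.1)) → Fin (Module.finrank ℝ (PB E M u.1)) → ℝ :=
    fun i m ↦ B (PiField.eval u (N.curv X Y (e i))) (b m)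
  have ht : ∀ i j, t i j = -t j i := fun i j ↦ by
    simp only [t]
    rw [← he j, hskew, hsymm, he i]
  have hr := eigenvalue_eq_zero_of_skew ht
    (r := fun i j k l ↦ B (PiField.eval u (N.curv (e i) (e j) (e k))) (b l))
    (c := (N.extDer A X Y).1 u) fun i j k l ↦ by
      have hric := congrArg (fun Z ↦ B (PiField.eval u Z) (b l))
        (N.curv_act_of_recurrent A hA X Y (e i) (e j) (e k))
      simp only [map_sub, map_neg, LinearMap.sub_apply, LinearMap.neg_apply, PiField.eval_smul,
        map_smul, LinearMap.smul_apply, smul_eq_mul] at hric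
      -- Skewness moves `R(X, Y)` from the value of `R` to the vector paired with it. The Ricci
      -- identity becomes a derivation acting on all four slots, with `d̄A(X, Y)` as eigenvalue.
      rw [h1 (N.curv X Y (e i)), h2 _ (N.curv X Y (e j)), h3 _ _ (N.curv X Y (e k)), ← he l,
        hskew, hexp (N.curv X Y (e l))] at hric
      simp only [map_sum, map_smul, LinearMap.sum_apply, LinearMap.smul_apply, smul_eq_mul,
        he] at hric
      simp only [t]
      linarith
  refine hr.imp_right fun h0 U V W ↦ ?_
  have h4 : ∀ i j k, PiField.eval u (N.curv (e i) (e j) (e k)) = 0 := fun i j k ↦ by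
    rw [hexp]
    exact Finset.sum_eq_zero fun l _ ↦ by rw [h0, zero_smul]
  change PiField.eval u (N.curv U V W) = 0
  rw [h1]
  refine Finset.sum_eq_zero fun i _ ↦ ?_
  rw [h2]
  simp only [h3 (e i) (e _) W, h4, smul_zero, Finset.sum_const_zero]

end Main


/-! ### Consequences for the tensors on `𝒯M` -/

section Main

variable {E : Type*} [NormedAddCommGroup E] [NormedSpace ℝ E] [FiniteDimensional ℝ E]
  {M : Type*} [TopologicalSpace M] [ChartedSpace E M] [IsManifold 𝓘(ℝ, E) ∞ M]
  {L : TangentBundle 𝓘(ℝ, E) M → ℝ} {D : Conn E M}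

theorem dBar_eq_zero_or_hCurv_eq_zero [T2Space M] (hL : IsFinslerStructure L) (hD : IsCartanConnection L D)
    (hint : IsHorizontallyIntegrable D) (hn : 2 ≤ Module.finrank ℝ E)
    {A B : Π u : TangentBundle 𝓘(ℝ, E) M, PB E M u →L[ℝ] ℝ} (hA : IsScalarForm A)
    (hrec : RecurrenceEquation L D A B)
    {X Y : Π u : TangentBundle 𝓘(ℝ, E) M, PB E M u} (hX : IsPiVectorField X)
    (hY : IsPiVectorField Y) {u : TangentBundle 𝓘(ℝ, E) M} (hu : u ∈ slit E M) :
    dBar D A X Y u = 0 ∨ ∀ {U V W : Π u : TangentBundle 𝓘(ℝ, E) M, PB E M u},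
      IsPiVectorField U → IsPiVectorField V → IsPiVectorField W → hCurv D U V W u = 0 := by
  rw [← extDer_res hL hD hint hA hX hY ⟨u, hu⟩]
  refine (extDer_eq_zero_or_curv_eq_zero hL hD hint hA.toFun
    (nablaCurv_eq hL hD hint hn hA hrec) ⟨u, hu⟩ hX.res hY.res).imp_right
    fun h U V W hU hV hW ↦ ?_
  rw [← h hU.res hV.res hW.res, curv_res]
  rfl

theorem curvActCurv_eq_zero [T2Space M] (hL : IsFinslerStructure L) (hD : IsCartanConnection L D)
    (hint : IsHorizontallyIntegrable D) (hn : 2 ≤ Module.finrank ℝ E)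
    {A B : Π u : TangentBundle 𝓘(ℝ, E) M, PB E M u →L[ℝ] ℝ} (hA : IsScalarForm A)
    (hrec : RecurrenceEquation L D A B)
    {X Y U V W Z : Π u : TangentBundle 𝓘(ℝ, E) M, PB E M u} (hX : IsPiVectorField X)
    (hY : IsPiVectorField Y) (hU : IsPiVectorField U) (hV : IsPiVectorField V)
    (hW : IsPiVectorField W) (hZ : IsPiVectorField Z)
    (u : slit E M) : curvActCurv L D X Y U V W Z u = 0 := by
  obtain ⟨B', hB, -⟩ := exists_bilinForm_metric hL u.2
  have hc : ∀ {P Q S : Π u : TangentBundle 𝓘(ℝ, E) M, PB E M u}, IsPiVectorField P →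
      IsPiVectorField Q → IsPiVectorField S → IsPiVectorField (hCurv D P Q S) :=
    isPiVectorField_hCurv hD hint
  unfold curvActCurv curvForm
  simp only [← hB]
  -- If `d̄A(X, Y)` vanishes at `u`, the Ricci identity paired with `Z` is the claim, up to skewness
  -- in the last slot. If `R` vanishes at `u`, every term is zero.
  rcases dBar_eq_zero_or_hCurv_eq_zero hL hD hint hn hA hrec hX hY u.2 with h | h
  · have hric := congrArg (PiField.eval u)
      ((hCalculus hL hD hint).curv_act_of_recurrent hA.toFun
        (nablaCurv_eq hL hD hint hn hA hrec) hX.res hY.res hU.res hV.res hW.res)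
    have hext : ((hCalculus hL hD hint).extDer hA.toFun hX.res hY.res).1 u = 0 :=
      (extDer_res hL hD hint hA hX hY u).trans h
    simp only [map_sub, map_neg, PiField.eval_smul, hext, zero_smul, neg_zero] at hric
    simp only [curv_res hL hD hint hU hV hW, curv_res hL hD hint hX hY hU,
      curv_res hL hD hint hX hY hV, curv_res hL hD hint hX hY hW,
      curv_res hL hD hint hX hY (hc hU hV hW), curv_res hL hD hint (hc hX hY hU) hV hW,
      curv_res hL hD hint hU (hc hX hY hV) hW, curv_res hL hD hint hU hV (hc hX hY hW)] at hric
    have hric' : hCurv D X Y (hCurv D U V W) u - hCurv D (hCurv D X Y U) V W u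
        - hCurv D U (hCurv D X Y V) W u - hCurv D U V (hCurv D X Y W) u = 0 := hric
    have hskew := congrArg (fun f ↦ f.1 u) ((hCalculus hL hD hint).curv_skew
      (nabla_etaField hL hD hint) eq_zero_of_smul_etaField (metricHom hL)
      (hCalculus_der_metricHom hL hD hint) hX.res hY.res (hc hU hV hW).res hZ.res)
    rw [curv_res hL hD hint hX hY (hc hU hV hW), curv_res hL hD hint hX hY hZ] at hskew
    have hneg : (-(metricHom hL) (hc hU hV hW).res (hc hX hY hZ).res).1 u =
      -((metricHom hL) (hc hU hV hW).res (hc hX hY hZ).res).1 u := rfl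
    simp only [hneg, metricHom_apply] at hskew
    have hskew' : B' (hCurv D X Y (hCurv D U V W) u) (Z u) =
        -B' (hCurv D U V W u) (hCurv D X Y Z u) := by
      rw [hB, hB]; exact hskew
    have hfin := congrArg (fun v ↦ B' v (Z u)) hric'
    simp only [map_sub, LinearMap.sub_apply, map_zero, LinearMap.zero_apply] at hfin
    linarith
  · rw [h (hc hX hY hU) hV hW, h hU (hc hX hY hV) hW, h hU hV (hc hX hY hW), h hU hV hW]
    simp

/-- The recurrence equation identifies each term with a covariant derivative of `R`, so the second
Bianchi identity applies. -/
theorem recTensor_cyclic (hL : IsFinslerStructure L) (hD : IsCartanConnection L D)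
    (hint : IsHorizontallyIntegrable D)
    {A B : Π u : TangentBundle 𝓘(ℝ, E) M, PB E M u →L[ℝ] ℝ} (hrec : RecurrenceEquation L D A B)
    {X Y Z W : Π u : TangentBundle 𝓘(ℝ, E) M, PB E M u} (hX : IsPiVectorField X)
    (hY : IsPiVectorField Y) (hZ : IsPiVectorField Z) (hW : IsPiVectorField W) (u : slit E M) :
    recTensor L D A B X Y Z W u + recTensor L D A B Y Z X W u + recTensor L D A B Z X Y W u = 0 := by
  have h := congrArg (PiField.eval u)
    ((hCalculus hL hD hint).second_bianchi hX.res hY.res hZ.res hW.res)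
  rw [map_add, map_add, map_zero, eval_nablaCurv_res, eval_nablaCurv_res, eval_nablaCurv_res,
    hrec X Y Z W hX hY hZ hW u.1 u.2, hrec Y Z X W hY hZ hX hW u.1 u.2,
    hrec Z X Y W hZ hX hY hW u.1 u.2] at h
  exact h

end Main

end Finsler

theorem mainTheorem6 {E : Type*} [NormedAddCommGroup E] [NormedSpace ℝ E] [FiniteDimensional ℝ E]
    (hn : 3 ≤ Module.finrank ℝ E)
    {M : Type*} [TopologicalSpace M] [T2Space M] [SecondCountableTopology M]
    [ChartedSpace E M] [IsManifold 𝓘(ℝ, E) ∞ M]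
    (L : TangentBundle 𝓘(ℝ, E) M → ℝ) (hL : Finsler.IsFinslerStructure L)
    (D : Finsler.Conn E M) (hD : Finsler.IsCartanConnection L D)
    (hint : Finsler.IsHorizontallyIntegrable D)
    (A B : Π u : TangentBundle 𝓘(ℝ, E) M, Finsler.PB E M u →L[ℝ] ℝ)
    (hA : Finsler.IsScalarForm A) (hB : Finsler.IsScalarForm B)
    (hrec : Finsler.RecurrenceEquation L D A B) :
    (∀ X Y Z W : Π u : TangentBundle 𝓘(ℝ, E) M, Finsler.PB E M u,
      Finsler.IsPiVectorField X → Finsler.IsPiVectorField Y →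
      Finsler.IsPiVectorField Z → Finsler.IsPiVectorField W →
      ∀ u ∈ Finsler.slit E M,
        Finsler.recTensor L D A B X Y Z W u + Finsler.recTensor L D A B Y Z X W u
          + Finsler.recTensor L D A B Z X Y W u = 0) ∧
    (∀ X Y : Π u : TangentBundle 𝓘(ℝ, E) M, Finsler.PB E M u,
      Finsler.IsPiVectorField X → Finsler.IsPiVectorField Y →
      ∀ u ∈ Finsler.slit E M,
        (Finsler.IsGeneralizedRecurrent L D A B → Finsler.dBar D A X Y u = 0) ∧
        (Finsler.HCurvNeZeroAt D u → Finsler.dBar D A X Y u = 0) ∧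
        Finsler.dBar D B X Y u + Finsler.wedge A B X Y u = 0) ∧
    (∀ X Y U V W Z : Π u : TangentBundle 𝓘(ℝ, E) M, Finsler.PB E M u,
      Finsler.IsPiVectorField X → Finsler.IsPiVectorField Y → Finsler.IsPiVectorField U →
      Finsler.IsPiVectorField V → Finsler.IsPiVectorField W → Finsler.IsPiVectorField Z →
      ∀ u ∈ Finsler.slit E M, Finsler.curvActCurv L D X Y U V W Z u = 0) := by
  have hn2 : 2 ≤ Module.finrank ℝ E := by omega
  have hB0 : ∀ u ∈ Finsler.slit E M, B u = 0 := fun u hu ↦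
    Finsler.formB_eq_zero hL hD hint hn2 hrec hu
  refine ⟨fun X Y Z W hX hY hZ hW u hu ↦
    Finsler.recTensor_cyclic hL hD hint hrec hX hY hZ hW ⟨u, hu⟩,
    fun X Y hX hY u hu ↦ ⟨fun hgen ↦ ?_, fun hR ↦ ?_, ?_⟩,
    fun X Y U V W Z hX hY hU hV hW hZ u hu ↦
      Finsler.curvActCurv_eq_zero hL hD hint hn2 hA hrec hX hY hU hV hW hZ ⟨u, hu⟩⟩
  -- Generalized recurrence demands a point with `B ≠ 0`, which contradicts `B = 0`; this clause is
  -- vacuous.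
  · obtain ⟨w, hw, hBw⟩ := hgen.formB_ne_zero
    exact absurd (hB0 w hw) hBw
  · obtain ⟨U, V, W, hU, hV, hW, hne⟩ := hR
    exact (Finsler.dBar_eq_zero_or_hCurv_eq_zero hL hD hint hn2 hA hrec hX hY hu).resolve_right
      fun h ↦ hne (h hU hV hW)
  -- `B` vanishes on all of the open set `𝒯M`, so the derivatives of `B(Y)` vanish as well as its
  -- values.
  · have hc : ∀ Y : Π u : TangentBundle 𝓘(ℝ, E) M, Finsler.PB E M u,
        mvfderiv 𝓘(ℝ, E).tangent (fun w ↦ B w (Y w)) u = 0 := fun Y ↦ by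
      rw [Finsler.mvfderiv_congr (g := fun _ ↦ 0) (fun w hw ↦ by rw [hB0 w hw]; rfl) hu]
      simp [mvfderiv]
    simp [Finsler.dBar, Finsler.hCovForm, Finsler.wedge, hc, hB0 u hu]
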